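/- Let $K$ be a number field with ring of integers $\mathcal{O}_K$, let $\mathfrak{d}$ be a nonzero prime ideal of $\mathcal{O}_K$ containing $2$, and let $K_\mathfrak{d}$ be the completion of $K$ at $\mathfrak{d}$. For $b,c\in K^\times$ let $(b,c)_\mathfrak{d}\in\{\pm1\}$ be the Hilbert symbol: it is $1$ if $z^2=bx^2+cy^2$ has a solution $(x,y,z)\neq(0,0,0)$ in $K_\mathfrak{d}$, and $-1$ otherwise. Let $\varphi$ be a non-degenerate quadratic form over $K$ of dimension $n$ with a diagonalization $\varphi\cong\langle a_1,\dots,a_n\rangle$, $a_i\in K^\times$, and put $$\det\varphi=\prod_{i=1}^n a_i,\qquad \operatorname{disc}\varphi=(-1)^{n(n-1)/2}\det\varphi,\qquad s_\mathfrak{d}(\varphi)=\prod_{1\le i<j\le n}(a_i,a_j)_\mathfrak{d}.$$ Consider the following procedure, which has access to a subroutine testing whether an element of $K$ is a square in $K_\mathfrak{d}$ and to a subroutine returning Hilbert symbols $(b,c)_\mathfrak{d}$. On input $(a_1,\dots,a_n)$ it returns: 1. if $n\le 1$: false; 2. if $n=2$: true if $\operatorname{disc}\varphi$ is a square in $K_\mathfrak{d}$,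 otherwise false; 3. if $n=3$: true if $(-1,-\det\varphi)_\mathfrak{d}=s_\mathfrak{d}(\varphi)$, otherwise false; 4. if $n=4$: true if $\det\varphi$ is not a square in $K_\mathfrak{d}$; if $\det\varphi$ is a square in $K_\mathfrak{d}$, true if $s_\mathfrak{d}(\varphi)=(-1,-1)_\mathfrak{d}$ and otherwise false; 5. if $n\ge 5$: true. Then the procedure returns true if and only if $\varphi\otimes K_\mathfrak{d}$ is isotropic (has a nontrivial zero). Explicitly: - if $n\le 1$, then $\varphi\otimes K_\mathfrak{d}$ is anisotropic; - if $n=2$, then $\varphi\otimes K_\mathfrak{d}$ is isotropic if and only if $-\det\varphi$ is a square in $K_\mathfrak{d}$; - if $n=3$, then $\varphi\otimes K_\mathfrak{d}$ is isotropic if and only if $(-1,-\det\varphi)_\mathfrak{d}=s_\mathfrak{d}(\varphi)$; - if $n=4$, then $\varphi\otimes K_\mathfrak{d}$ is isotropic if and only if $\det\varphi$ is not a square in $K_\mathfrak{d}$ or $s_\mathfrak{d}(\varphi)=(-1,-1)_\mathfrak{d}$; - if $n\ge 5$, then $\varphi\otimes K_\mathfrak{d}$ is isotropic. -/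

import Mathlib

open scoped TensorProduct
open IsDedekindDomain

namespace DyadicIsotropy

/-- A quadratic form is isotropic if it has a nontrivial zero. -/
def IsIsotropic {F V : Type*} [Field F] [AddCommGroup V] [Module F V]
    (φ : QuadraticForm F V) : Prop :=
  ∃ x : V, x ≠ 0 ∧ φ x = 0

open Classical in
/-- The Hilbert symbol `(a, b)` of a field `F` (used for nonzero `a`, `b`): it is `1` if
`z² = a x² + b y²` has a nontrivial solution in `F`, and `-1` otherwise. -/
noncomputable def hilbertSymbol {F : Type*} [Field F] (a b : F) : ℤˣ :=
  if ∃ x y z : F, (x ≠ 0 ∨ y ≠ 0 ∨ z ≠ 0) ∧ z ^ 2 = a * x ^ 2 + b * y ^ 2 then 1 else -1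

/-- The product `∏_{i < j} h(a_i, a_j)`. When `h` is the Hilbert symbol of a completion, this is
the Hasse invariant of the form `⟨a_1, …, a_n⟩` at the corresponding prime. -/
def hasseInvariant {K : Type*} (h : K → K → ℤˣ) {n : ℕ} (a : Fin n → K) : ℤˣ :=
  ∏ i : Fin n, ∏ j ∈ Finset.Ioi i, h (a i) (a j)

/-- The determinant of the diagonal form `⟨a_1, …, a_n⟩`. -/
def diagDet {K : Type*} [Field K] {n : ℕ} (a : Fin n → K) : K :=
  ∏ i : Fin n, a i

/-- The discriminant `(-1)^{n(n-1)/2} det` of the diagonal form `⟨a_1, …, a_n⟩`. -/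
def diagDisc {K : Type*} [Field K] {n : ℕ} (a : Fin n → K) : K :=
  (-1) ^ (n * (n - 1) / 2) * diagDet a

/-- The decision procedure, run on the diagonal form `⟨a_1, …, a_n⟩` over `K`. It calls two
subroutines: `isLocalSquare`, a test for being a square in the completion, and `hilbert`,
which returns Hilbert symbols in the completion. -/
def isotropyTest {K : Type*} [Field K] (isLocalSquare : K → Bool) (hilbert : K → K → ℤˣ)
    {n : ℕ} (a : Fin n → K) : Bool :=
  if n ≤ 1 then false
  else if n = 2 then isLocalSquare (diagDisc a)
  else if n = 3 then decide (hilbert (-1) (-diagDet a) = hasseInvariant hilbert a)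
  else if n = 4 then
    if isLocalSquare (diagDet a) then decide (hasseInvariant hilbert a = hilbert (-1) (-1))
    else true
  else true

section Completion

variable {K : Type*} [Field K] [NumberField K] (v : HeightOneSpectrum (NumberField.RingOfIntegers K))

/-- The form `φ ⊗ K_v` over the completion `K_v` of the number field `K` at a finite prime. -/
noncomputable def atPrime {V : Type*} [AddCommGroup V] [Module K V] (φ : QuadraticForm K V) :
    QuadraticForm (v.adicCompletion K) (v.adicCompletion K ⊗[K] V) :=
  letI : Invertible (2 : K) := invertibleOfNonzero two_ne_zero
  φ.baseChange (v.adicCompletion K)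

/-- `c ∈ K` is a square in the completion `K_v`. -/
def IsLocalSquare (c : K) : Prop :=
  IsSquare (algebraMap K (v.adicCompletion K) c)

/-- The Hilbert symbol `(b, c)_v` of `b, c ∈ K` at the prime `v`. -/
noncomputable def localHilbert (b c : K) : ℤˣ :=
  hilbertSymbol (algebraMap K (v.adicCompletion K) b) (algebraMap K (v.adicCompletion K) c)

end Completion

end DyadicIsotropy

/-!
Let `F` be the completion of `K` at a prime above `2`. After base change the form `φ` is still
diagonal with the coefficients `a i` (`isIsotropic_baseChange_iff`), so everything is a statement
about diagonal forms over `F`. It is a formal consequence of three facts about `F`, collected in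
`HasLocalSymbol`.

* For `a ≠ 0` the values of `x² - a y²` have index at most two in `Fˣ`. This makes the Hilbert
  symbol bimultiplicative.
* If `a` is not a square, some element is not of the form `x² - a y²`. So the symbol is
  nondegenerate.
* `-7` is a square, as `x² + x + 2` has a root by Hensel's lemma.

Given these, dimension three is the solubility of the equation that defines `(-ac, -bc)`, expanded
by bimultiplicativity. In dimension four one asks for a common nonzero value of `⟨a, b⟩` and
`⟨-c, -d⟩`, which prescribes the values at `t` of the characters `(-ab, ·)` and `(-cd, ·)`. If
`abcd` is not a square these characters are distinct, and `t` exists; otherwise they coincide, and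
the condition becomes one on the Hasse invariant. In dimension five either some four of the
coefficients have nonsquare product, or the form is similar to `⟨1, 1, 1, 1, 1⟩`, which vanishes
at `(√-7, 2, 1, 1, 1)`.

The first two facts hold for the fraction field of every henselian discrete valuation ring with
finite residue field `k` of characteristic two and `2 ≠ 0` (`hasLocalSymbol_of_henselian`). Let
`π` be a uniformizer and `e` the valuation of `2`. Up to squares, a nonsquare `a` is of the form
`πε`, or `1 + π^{2d+1} ε` with `2d + 1 < 2e`, or `1 + 4γ` with `T² + T - γ` irreducible over `k`,
where `ε` is a unit (`square_class_cases`). In the last case, which is the unramified one, the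
norms are the elements of even valuation. In the others the norms fill every graded piece of the
filtration `1 + π^i O` of the units except one, where they fill a subgroup of index two, namely the
image of an additive map `x ↦ px + qx²` of `k` (`mem_or_mem_or_mul_mem_of_filtration`,
`normUnits_index_of_prime`, `normUnits_index_of_unit`). Nondegeneracy is reduced to the unramified
case by the identity `(u, w) = (u + w, -uw)` (`IsNorm.add_left`).
-/

namespace DyadicIsotropy

/-! ### Norms from quadratic extensions and the Hilbert symbol -/

section Field

variable {F : Type*} [Field F]

/-- `t` is a value of the form `x² - a y²`; when `a` is not a square, these are the norms from
`F(√a)`. -/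
def IsNorm (a t : F) : Prop :=
  ∃ x y : F, t = x ^ 2 - a * y ^ 2

namespace IsNorm

lemma sq (a x : F) : IsNorm a (x ^ 2) := ⟨x, 0, by ring⟩

lemma neg_self (a : F) : IsNorm a (-a) := ⟨0, 1, by ring⟩

lemma mul {a s t : F} (hs : IsNorm a s) (ht : IsNorm a t) : IsNorm a (s * t) := by
  obtain ⟨x, y, rfl⟩ := hs
  obtain ⟨z, w, rfl⟩ := ht
  exact ⟨x * z + a * (y * w), x * w + y * z, by ring⟩

lemma inv {a t : F} (ht : IsNorm a t) : IsNorm a t⁻¹ := by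
  have h := ht.mul (sq a t⁻¹)
  rcases eq_or_ne t 0 with rfl | h0
  · simpa using h
  · convert h using 1
    field_simp

lemma of_mul_right {a s t : F} (ht : IsNorm a t) (h0 : t ≠ 0) (h : IsNorm a (s * t)) :
    IsNorm a s := by
  have h' := h.mul ht.inv
  rwa [mul_inv_cancel_right₀ h0] at h'

lemma mul_sq_left {a t m : F} (hm : m ≠ 0) : IsNorm (a * m ^ 2) t ↔ IsNorm a t := by
  constructor
  · rintro ⟨x, y, rfl⟩
    exact ⟨x, m * y, by ring⟩
  · rintro ⟨x, y, rfl⟩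
    exact ⟨x, y / m, by field_simp⟩

lemma mul_sq_right {a t m : F} (hm : m ≠ 0) : IsNorm a (t * m ^ 2) ↔ IsNorm a t :=
  ⟨of_mul_right (sq a m) (pow_ne_zero 2 hm), fun h => h.mul (sq a m)⟩

/-- The form `x² - a y²` is hyperbolic, hence universal, when `a` is a nonzero square. -/
lemma of_isSquare [NeZero (2 : F)] {a : F} (ha : IsSquare a) (h0 : a ≠ 0) (t : F) :
    IsNorm a t := by
  obtain ⟨r, rfl⟩ := ha
  have hr : r ≠ 0 := by rintro rfl; simp at h0
  have h2 : (2 : F) ≠ 0 := NeZero.ne 2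
  exact ⟨(t + 1) / 2, (t - 1) / (2 * r), by field_simp; ring⟩

/-- The relation `(u, w) = (u + w, -uw)` between Hilbert symbols, in terms of norms. -/
lemma add_left [NeZero (2 : F)] {u w : F} (h : IsNorm u w) : IsNorm (u + w) (-(u * w)) := by
  obtain ⟨x, y, rfl⟩ := h
  by_cases hy : y = 1
  · subst hy
    rcases eq_or_ne x 0 with rfl | hx
    · exact ⟨u, 0, by ring⟩
    · refine of_isSquare ⟨x, by ring⟩ ?_ _
      convert pow_ne_zero 2 hx using 1
      ring
  · have hy' : y - 1 ≠ 0 := sub_ne_zero.mpr hy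
    exact ⟨(u * y + (x ^ 2 - u * y ^ 2)) / (y - 1), x / (y - 1), by field_simp; ring⟩

end IsNorm

lemma hilbertSymbol_eq_one_iff_isNorm [NeZero (2 : F)] {a b : F} (ha : a ≠ 0) :
    hilbertSymbol a b = 1 ↔ IsNorm a b := by
  have : hilbertSymbol a b = 1 ↔
      ∃ x y z : F, (x ≠ 0 ∨ y ≠ 0 ∨ z ≠ 0) ∧ z ^ 2 = a * x ^ 2 + b * y ^ 2 := by
    unfold hilbertSymbol
    split_ifs with h <;> simp [h]
  rw [this]
  constructor
  · rintro ⟨x, y, z, h, e⟩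
    by_cases hy : y = 0
    · subst hy
      have hx : x ≠ 0 := by
        rintro rfl
        have : z = 0 := by simpa using e
        simp_all
      exact IsNorm.of_isSquare ⟨z / x, by field_simp; linear_combination -e⟩ ha b
    · exact ⟨z / y, x / y, by field_simp; linear_combination -e⟩
  · rintro ⟨x, y, e⟩
    exact ⟨y, 1, x, by simp, by rw [e]; ring⟩

lemma hilbertSymbol_comm (a b : F) : hilbertSymbol a b = hilbertSymbol b a := by
  unfold hilbertSymbol
  congr 1
  apply propext
  constructor <;>
  · rintro ⟨x, y, z, h, e⟩
    exact ⟨y, x, z, by tauto, by rw [e]; ring⟩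

lemma IsNorm.symm [NeZero (2 : F)] {a b : F} (ha : a ≠ 0) (hb : b ≠ 0) (h : IsNorm a b) :
    IsNorm b a := by
  rwa [← hilbertSymbol_eq_one_iff_isNorm hb, hilbertSymbol_comm,
    hilbertSymbol_eq_one_iff_isNorm ha]

lemma hilbertSymbol_mul_sq_right [NeZero (2 : F)] {a b m : F} (ha : a ≠ 0) (hm : m ≠ 0) :
    hilbertSymbol a (b * m ^ 2) = hilbertSymbol a b := by
  have h : hilbertSymbol a (b * m ^ 2) = 1 ↔ hilbertSymbol a b = 1 := by
    rw [hilbertSymbol_eq_one_iff_isNorm ha, hilbertSymbol_eq_one_iff_isNorm ha,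
      IsNorm.mul_sq_right hm]
  rcases Int.units_eq_one_or (hilbertSymbol a (b * m ^ 2)) with h1 | h1 <;>
  rcases Int.units_eq_one_or (hilbertSymbol a b) with h2 | h2 <;> simp_all

lemma hilbertSymbol_neg_self [NeZero (2 : F)] {a : F} (ha : a ≠ 0) : hilbertSymbol a (-a) = 1 :=
  (hilbertSymbol_eq_one_iff_isNorm ha).2 (IsNorm.neg_self a)

/-! ### Isotropy of diagonal forms over a field with local Hilbert symbol theory -/

/-- The properties of a dyadic local field on which its isotropy criteria rest: each norm group has
index at most two in the multiplicative group, and equals it only for squares; and `-7` is a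
square. -/
structure HasLocalSymbol (F : Type*) [Field F] : Prop where
  norm_index_le_two : ∀ {a b c : F}, a ≠ 0 → b ≠ 0 → c ≠ 0 →
    IsNorm a b ∨ IsNorm a c ∨ IsNorm a (b * c)
  exists_not_isNorm : ∀ {a : F}, a ≠ 0 → ¬ IsSquare a → ∃ b, b ≠ 0 ∧ ¬ IsNorm a b
  isSquare_neg_seven : IsSquare (-7 : F)

/-- The diagonal form `⟨a_1, …, a_n⟩` has a nontrivial zero. -/
def DiagIsotropic {n : ℕ} (a : Fin n → F) : Prop :=
  ∃ x : Fin n → F, x ≠ 0 ∧ ∑ i, a i * x i ^ 2 = 0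

lemma DiagIsotropic.of_comp {m n : ℕ} {a : Fin n → F} {e : Fin m → Fin n}
    (he : Function.Injective e) (h : DiagIsotropic (a ∘ e)) : DiagIsotropic a := by
  obtain ⟨x, hx, hs⟩ := h
  refine ⟨Function.extend e x 0, ?_, ?_⟩
  · contrapose! hx
    funext i
    have := congrFun hx (e i)
    rwa [he.extend_apply] at this
  · rw [← hs, ← Finset.sum_subset (Finset.subset_univ (Finset.univ.image e)),
      Finset.sum_image (fun _ _ _ _ h => he h)]
    · exact Finset.sum_congr rfl fun i _ => by rw [he.extend_apply]; rfl
    · intro j _ hj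
      rw [Function.extend_apply']
      · simp
      · simpa using hj

lemma not_diagIsotropic_of_le_one {n : ℕ} (hn : n ≤ 1) {a : Fin n → F} (ha : ∀ i, a i ≠ 0) :
    ¬ DiagIsotropic a := by
  rintro ⟨x, hx, hs⟩
  interval_cases n
  · exact hx (Subsingleton.elim _ _)
  · apply hx
    funext i
    rw [Subsingleton.elim i 0]
    simpa [ha 0] using hs

lemma diagIsotropic_two_iff {a : Fin 2 → F} (ha : ∀ i, a i ≠ 0) :
    DiagIsotropic a ↔ IsSquare (-(a 0 * a 1)) := by
  have h0 := ha 0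
  have h1 := ha 1
  constructor
  · rintro ⟨x, hx, hs⟩
    rw [Fin.sum_univ_two] at hs
    have hx1 : x 1 ≠ 0 := by
      intro h
      have h' : x 0 = 0 := by simpa [h, h0] using hs
      exact hx (funext fun i => by fin_cases i <;> simpa)
    exact ⟨a 0 * x 0 / x 1, by field_simp; linear_combination -hs⟩
  · rintro ⟨r, hr⟩
    refine ⟨![r, a 0], fun h => h0 (by simpa using congrFun h 1), ?_⟩
    simp only [Fin.sum_univ_two, Matrix.cons_val_zero, Matrix.cons_val_one]
    linear_combination (-a 0) * hr

namespace HasLocalSymbol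

variable [NeZero (2 : F)] (hF : HasLocalSymbol F)
include hF

lemma hilbertSymbol_mul_right {a b c : F} (ha : a ≠ 0) (hb : b ≠ 0) (hc : c ≠ 0) :
    hilbertSymbol a (b * c) = hilbertSymbol a b * hilbertSymbol a c := by
  have h := hF.norm_index_le_two ha hb hc
  have h1 : IsNorm a b → (IsNorm a (b * c) ↔ IsNorm a c) := fun h =>
    ⟨fun h' => h.of_mul_right hb (by rwa [mul_comm]), h.mul⟩
  have h2 : IsNorm a c → (IsNorm a (b * c) ↔ IsNorm a b) := fun h =>
    ⟨h.of_mul_right hc, fun h' => h'.mul h⟩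
  simp only [← hilbertSymbol_eq_one_iff_isNorm ha] at h h1 h2
  rcases Int.units_eq_one_or (hilbertSymbol a (b * c)) with h3 | h3 <;>
  rcases Int.units_eq_one_or (hilbertSymbol a b) with h4 | h4 <;>
  rcases Int.units_eq_one_or (hilbertSymbol a c) with h5 | h5 <;> simp_all

lemma hilbertSymbol_mul_left {a b c : F} (ha : a ≠ 0) (hb : b ≠ 0) (hc : c ≠ 0) :
    hilbertSymbol (a * b) c = hilbertSymbol a c * hilbertSymbol b c := by
  rw [hilbertSymbol_comm, hF.hilbertSymbol_mul_right hc ha hb, hilbertSymbol_comm c,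
    hilbertSymbol_comm c]

lemma hilbertSymbol_self {a : F} (ha : a ≠ 0) : hilbertSymbol a a = hilbertSymbol (-1) a := by
  have h := hF.hilbertSymbol_mul_right ha (neg_ne_zero.mpr one_ne_zero) ha
  rw [neg_one_mul, hilbertSymbol_neg_self ha, hilbertSymbol_comm a (-1)] at h
  generalize hilbertSymbol a a = p at *
  generalize hilbertSymbol (-1) a = q at *
  revert p q
  decide

lemma hilbertSymbol_pow_right {a b : F} (ha : a ≠ 0) (hb : b ≠ 0) (n : ℕ) :
    hilbertSymbol a (b ^ n) = hilbertSymbol a b ^ n := by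
  induction n with
  | zero => simpa using (hilbertSymbol_eq_one_iff_isNorm ha).2 ⟨1, 0, by simp⟩
  | succ n ih => rw [pow_succ, hF.hilbertSymbol_mul_right ha (pow_ne_zero n hb) hb, ih, pow_succ]

/-- A nonzero `t` is represented by `⟨a, b⟩` iff `at` is a norm from `F(√(-ab))`. -/
lemma exists_binary_eq_iff {a b t : F} (ha : a ≠ 0) (hb : b ≠ 0) (ht : t ≠ 0) :
    (∃ x y, a * x ^ 2 + b * y ^ 2 = t) ↔
      hilbertSymbol (-(a * b)) t = hilbertSymbol (-(a * b)) a := by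
  have hab : -(a * b) ≠ 0 := neg_ne_zero.mpr (mul_ne_zero ha hb)
  have h1 : (∃ x y, a * x ^ 2 + b * y ^ 2 = t) ↔ IsNorm (-(a * b)) (a * t) := by
    constructor
    · rintro ⟨x, y, rfl⟩
      exact ⟨a * x, y, by ring⟩
    · rintro ⟨x, y, h⟩
      refine ⟨x / a, y, ?_⟩
      field_simp
      linear_combination -h
  rw [h1, ← hilbertSymbol_eq_one_iff_isNorm hab, hF.hilbertSymbol_mul_right hab ha ht]
  generalize hilbertSymbol (-(a * b)) t = p
  generalize hilbertSymbol (-(a * b)) a = q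
  revert p q
  decide

lemma diagIsotropic_three_iff {a : Fin 3 → F} (ha : ∀ i, a i ≠ 0) :
    DiagIsotropic a ↔ hilbertSymbol (-1) (-diagDet a) = hasseInvariant hilbertSymbol a := by
  have h0 := ha 0
  have h1 := ha 1
  have h2 := ha 2
  have hm : (-1 : F) ≠ 0 := neg_ne_zero.mpr one_ne_zero
  have h02 := mul_ne_zero h0 h2
  have h12 := mul_ne_zero h1 h2
  -- Solving for the last variable turns the equation into the one defining `(-ac, -bc)`.
  have key : DiagIsotropic a ↔ hilbertSymbol (-1 * (a 0 * a 2)) (-1 * (a 1 * a 2)) = 1 := by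
    rw [hilbertSymbol_eq_one_iff_isNorm (mul_ne_zero hm h02)]
    constructor
    · rintro ⟨x, hx, hs⟩
      rw [Fin.sum_univ_three] at hs
      by_cases hx1 : x 1 = 0
      · have hx0 : x 0 ≠ 0 := by
          intro h
          have h' : x 2 = 0 := by simpa [h, hx1, h2] using hs
          exact hx (funext fun i => by fin_cases i <;> simpa)
        refine IsNorm.of_isSquare ⟨a 2 * x 2 / x 0, ?_⟩ (mul_ne_zero hm h02) _
        rw [hx1] at hs
        field_simp
        linear_combination -hs
      · refine ⟨a 2 * x 2 / x 1, x 0 / x 1, ?_⟩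
        field_simp
        linear_combination -hs
    · rintro ⟨x, y, h⟩
      refine ⟨![a 2 * y, a 2, x], fun h => h2 (by simpa using congrFun h 1), ?_⟩
      simp only [Fin.sum_univ_three, Matrix.cons_val_zero, Matrix.cons_val_one, Matrix.cons_val]
      linear_combination (-a 2) * h
  have hd : diagDet a = a 0 * a 1 * a 2 := by simp [diagDet, Fin.prod_univ_three]
  have hs : hasseInvariant hilbertSymbol a =
      hilbertSymbol (a 0) (a 1) * hilbertSymbol (a 0) (a 2) * hilbertSymbol (a 1) (a 2) := by
    have e0 : Finset.Ioi (0 : Fin 3) = {1, 2} := by decide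
    have e1 : Finset.Ioi (1 : Fin 3) = {2} := by decide
    have e2 : Finset.Ioi (2 : Fin 3) = ∅ := by decide
    simp [hasseInvariant, Fin.prod_univ_three, e0, e1, e2]
  rw [key, hd, hs, ← neg_one_mul (_ * _ * _),
    hF.hilbertSymbol_mul_right hm hm (mul_ne_zero (mul_ne_zero h0 h1) h2),
    hF.hilbertSymbol_mul_right hm (mul_ne_zero h0 h1) h2, hF.hilbertSymbol_mul_right hm h0 h1,
    hF.hilbertSymbol_mul_left hm h02 (mul_ne_zero hm h12),
    hF.hilbertSymbol_mul_left h0 h2 (mul_ne_zero hm h12),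
    hF.hilbertSymbol_mul_right hm hm h12, hF.hilbertSymbol_mul_right h0 hm h12,
    hF.hilbertSymbol_mul_right h2 hm h12, hF.hilbertSymbol_mul_right hm h1 h2,
    hF.hilbertSymbol_mul_right h0 h1 h2, hF.hilbertSymbol_mul_right h2 h1 h2,
    hF.hilbertSymbol_self h2, hilbertSymbol_comm (a 0) (-1), hilbertSymbol_comm (a 2) (-1),
    hilbertSymbol_comm (a 2) (a 1)]
  generalize hilbertSymbol (-1 : F) (-1) = p
  generalize hilbertSymbol (-1 : F) (a 0) = q0
  generalize hilbertSymbol (-1 : F) (a 1) = q1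
  generalize hilbertSymbol (-1 : F) (a 2) = q2
  generalize hilbertSymbol (a 0) (a 1) = r01
  generalize hilbertSymbol (a 0) (a 2) = r02
  generalize hilbertSymbol (a 1) (a 2) = r12
  revert p q0 q1 q2 r01 r02 r12
  decide

/-- `⟨a, b, c, d⟩` is isotropic iff `⟨a, b⟩` and `⟨-c, -d⟩` represent a common nonzero element. -/
lemma diagIsotropic_four_iff_exists {a : Fin 4 → F} (ha : ∀ i, a i ≠ 0) :
    DiagIsotropic a ↔ ∃ t, t ≠ 0 ∧
      hilbertSymbol (-(a 0 * a 1)) t = hilbertSymbol (-(a 0 * a 1)) (a 0) ∧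
      hilbertSymbol (-(a 2 * a 3)) t = hilbertSymbol (-(a 2 * a 3)) (-a 2) := by
  have h0 := ha 0
  have h1 := ha 1
  have h2 := ha 2
  have h3 := ha 3
  have h01 : -(a 0 * a 1) ≠ 0 := neg_ne_zero.mpr (mul_ne_zero h0 h1)
  have h23 : -(a 2 * a 3) ≠ 0 := neg_ne_zero.mpr (mul_ne_zero h2 h3)
  have e01 := fun t => hF.exists_binary_eq_iff (t := t) h0 h1
  have e23 := fun t => hF.exists_binary_eq_iff (t := t) (neg_ne_zero.mpr h2) (neg_ne_zero.mpr h3)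
  simp only [neg_mul_neg] at e23
  constructor
  · rintro ⟨x, hx, hs⟩
    rw [Fin.sum_univ_four] at hs
    by_cases ht : a 0 * x 0 ^ 2 + a 1 * x 1 ^ 2 = 0
    · by_cases hx1 : x 0 = 0 ∧ x 1 = 0
      · have hx2 : x 2 ≠ 0 := by
          intro h
          have h' : x 3 = 0 := by simpa [h, hx1, h3] using hs
          exact hx (funext fun i => by fin_cases i <;> simp [hx1, h, h'])
        have hx3 : x 3 ≠ 0 := by
          intro h
          exact hx2 (by simpa [h, hx1, h2] using hs)
        have hsq : IsSquare (-(a 2 * a 3)) := by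
          refine ⟨a 2 * x 2 / x 3, ?_⟩
          field_simp
          linear_combination -hs + ht
        refine ⟨a 0, h0, rfl, ?_⟩
        rw [(hilbertSymbol_eq_one_iff_isNorm h23).2 (IsNorm.of_isSquare hsq h23 _),
          (hilbertSymbol_eq_one_iff_isNorm h23).2 (IsNorm.of_isSquare hsq h23 _)]
      · have hx1' : x 1 ≠ 0 := by
          intro h
          exact hx1 ⟨by simpa [h, h0] using ht, h⟩
        have hsq : IsSquare (-(a 0 * a 1)) := by
          refine ⟨a 0 * x 0 / x 1, ?_⟩
          field_simp
          linear_combination -ht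
        refine ⟨-a 2, neg_ne_zero.mpr h2, ?_, rfl⟩
        rw [(hilbertSymbol_eq_one_iff_isNorm h01).2 (IsNorm.of_isSquare hsq h01 _),
          (hilbertSymbol_eq_one_iff_isNorm h01).2 (IsNorm.of_isSquare hsq h01 _)]
    · exact ⟨_, ht, (e01 _ ht).1 ⟨_, _, rfl⟩,
        (e23 _ ht).1 ⟨x 2, x 3, by linear_combination -hs⟩⟩
  · rintro ⟨t, ht, ht1, ht2⟩
    obtain ⟨x, y, hxy⟩ := (e01 t ht).2 ht1
    obtain ⟨z, w, hzw⟩ := (e23 t ht).2 ht2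
    refine ⟨![x, y, z, w], fun h => ht ?_, ?_⟩
    · have hx : x = 0 := by simpa using congrFun h 0
      have hy : y = 0 := by simpa using congrFun h 1
      rw [← hxy, hx, hy]
      ring
    · simp only [Fin.sum_univ_four, Matrix.cons_val_zero, Matrix.cons_val_one, Matrix.cons_val]
      linear_combination hxy - hzw

lemma exists_hilbertSymbol_eq_neg_one {a : F} (ha : a ≠ 0) (h : ¬ IsSquare a) :
    ∃ t, t ≠ 0 ∧ hilbertSymbol a t = -1 := by
  obtain ⟨t, ht, hn⟩ := hF.exists_not_isNorm ha h
  exact ⟨t, ht, (Int.units_eq_one_or _).resolve_left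
    fun h => hn ((hilbertSymbol_eq_one_iff_isNorm ha).1 h)⟩

/-- When `-ab` and `-cd` lie in different square classes, the characters `(-ab, ·)` and `(-cd, ·)`
are distinct, and together they take every pair of values if both are nontrivial. If one of them
is trivial, the condition it imposes on a common value holds automatically. -/
lemma diagIsotropic_four_of_not_isSquare {a : Fin 4 → F} (ha : ∀ i, a i ≠ 0)
    (h : ¬ IsSquare (diagDet a)) : DiagIsotropic a := by
  have h0 := ha 0
  have h1 := ha 1
  have h2 := ha 2
  have h3 := ha 3
  have h01 : -(a 0 * a 1) ≠ 0 := neg_ne_zero.mpr (mul_ne_zero h0 h1)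
  have h23 : -(a 2 * a 3) ≠ 0 := neg_ne_zero.mpr (mul_ne_zero h2 h3)
  have hd : diagDet a = -(a 0 * a 1) * -(a 2 * a 3) := by
    simp only [diagDet, Fin.prod_univ_four]
    ring
  rw [hF.diagIsotropic_four_iff_exists ha]
  by_cases s01 : IsSquare (-(a 0 * a 1))
  · refine ⟨-a 2, neg_ne_zero.mpr h2, ?_, rfl⟩
    rw [(hilbertSymbol_eq_one_iff_isNorm h01).2 (IsNorm.of_isSquare s01 h01 _),
      (hilbertSymbol_eq_one_iff_isNorm h01).2 (IsNorm.of_isSquare s01 h01 _)]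
  by_cases s23 : IsSquare (-(a 2 * a 3))
  · refine ⟨a 0, h0, rfl, ?_⟩
    rw [(hilbertSymbol_eq_one_iff_isNorm h23).2 (IsNorm.of_isSquare s23 h23 _),
      (hilbertSymbol_eq_one_iff_isNorm h23).2 (IsNorm.of_isSquare s23 h23 _)]
  obtain ⟨t, ht, et⟩ := hF.exists_hilbertSymbol_eq_neg_one h01 s01
  obtain ⟨u, hu, eu⟩ := hF.exists_hilbertSymbol_eq_neg_one h23 s23
  rw [hd] at h
  obtain ⟨w, hw, ew⟩ := hF.exists_hilbertSymbol_eq_neg_one (mul_ne_zero h01 h23) h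
  rw [hF.hilbertSymbol_mul_left h01 h23 hw] at ew
  have mul3 : ∀ (c : F), c ≠ 0 → ∀ i j k : ℕ, hilbertSymbol c (t ^ i * u ^ j * w ^ k) =
      hilbertSymbol c t ^ i * hilbertSymbol c u ^ j * hilbertSymbol c w ^ k := by
    intro c hc i j k
    rw [hF.hilbertSymbol_mul_right hc (mul_ne_zero (pow_ne_zero i ht) (pow_ne_zero j hu))
      (pow_ne_zero k hw), hF.hilbertSymbol_mul_right hc (pow_ne_zero i ht) (pow_ne_zero j hu),
      hF.hilbertSymbol_pow_right hc ht, hF.hilbertSymbol_pow_right hc hu,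
      hF.hilbertSymbol_pow_right hc hw]
  -- The values of the two characters at the products `t^i u^j w^k` exhaust all pairs of signs.
  have gen : ∀ x y z z' A B : ℤˣ, z * z' = -1 → ∃ i j k : Fin 2,
      (-1) ^ (i : ℕ) * y ^ (j : ℕ) * z ^ (k : ℕ) = A ∧
      x ^ (i : ℕ) * (-1) ^ (j : ℕ) * z' ^ (k : ℕ) = B := by decide
  obtain ⟨i, j, k, hA, hB⟩ := gen (hilbertSymbol (-(a 2 * a 3)) t) (hilbertSymbol (-(a 0 * a 1)) u)
    _ _ (hilbertSymbol (-(a 0 * a 1)) (a 0)) (hilbertSymbol (-(a 2 * a 3)) (-a 2)) ew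
  refine ⟨t ^ (i : ℕ) * u ^ (j : ℕ) * w ^ (k : ℕ), mul_ne_zero (mul_ne_zero (pow_ne_zero _ ht)
    (pow_ne_zero _ hu)) (pow_ne_zero _ hw), ?_, ?_⟩
  · rw [mul3 _ h01, et, hA]
  · rw [mul3 _ h23, eu, hB]

lemma diagIsotropic_four_iff_of_isSquare {a : Fin 4 → F} (ha : ∀ i, a i ≠ 0)
    (h : IsSquare (diagDet a)) :
    DiagIsotropic a ↔ hasseInvariant hilbertSymbol a = hilbertSymbol (-1 : F) (-1) := by
  have h0 := ha 0
  have h1 := ha 1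
  have h2 := ha 2
  have h3 := ha 3
  have hm : (-1 : F) ≠ 0 := neg_ne_zero.mpr one_ne_zero
  have m01 := mul_ne_zero h0 h1
  have m02 := mul_ne_zero h0 h2
  have m012 := mul_ne_zero m01 h2
  have h01 : -(a 0 * a 1) ≠ 0 := neg_ne_zero.mpr m01
  have h23 : -(a 2 * a 3) ≠ 0 := neg_ne_zero.mpr (mul_ne_zero h2 h3)
  obtain ⟨r, hr⟩ := h
  have hr' : a 0 * a 1 * a 2 * a 3 = r * r := by rw [← hr, diagDet, Fin.prod_univ_four]
  have hr0 : r ≠ 0 := by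
    rintro rfl
    exact mul_ne_zero m012 h3 (by rw [hr', mul_zero])
  -- The last coefficient is `abc` up to a square, so `-cd` and `-ab` define the same character.
  have e3 : a 3 = a 0 * a 1 * a 2 * (r / (a 0 * a 1 * a 2)) ^ 2 := by
    field_simp
    linear_combination hr'
  have q0 : r / (a 0 * a 1 * a 2) ≠ 0 := div_ne_zero hr0 m012
  have c3 : ∀ x : F, x ≠ 0 → hilbertSymbol x (a 3) =
      hilbertSymbol x (a 0) * hilbertSymbol x (a 1) * hilbertSymbol x (a 2) := by
    intro x hx
    rw [e3, hilbertSymbol_mul_sq_right hx q0, hF.hilbertSymbol_mul_right hx m01 h2,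
      hF.hilbertSymbol_mul_right hx h0 h1]
  have c23 : ∀ x : F, x ≠ 0 → hilbertSymbol (-(a 2 * a 3)) x = hilbertSymbol (-(a 0 * a 1)) x := by
    intro x hx
    have : -(a 2 * a 3) = -(a 0 * a 1) * (r / (a 0 * a 1)) ^ 2 := by
      field_simp
      linear_combination -hr'
    rw [this, hilbertSymbol_comm, hilbertSymbol_mul_sq_right hx (div_ne_zero hr0 m01),
      hilbertSymbol_comm]
  have key : DiagIsotropic a ↔
      hilbertSymbol (-(a 0 * a 1)) (a 0) = hilbertSymbol (-(a 0 * a 1)) (-a 2) := by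
    rw [hF.diagIsotropic_four_iff_exists ha]
    constructor
    · rintro ⟨t, ht, ht1, ht2⟩
      rw [c23 t ht, c23 _ (neg_ne_zero.mpr h2)] at ht2
      rw [← ht1, ht2]
    · intro h
      exact ⟨a 0, h0, rfl, by rw [c23 _ h0, c23 _ (neg_ne_zero.mpr h2), h]⟩
  have hs : hasseInvariant hilbertSymbol a =
      hilbertSymbol (a 0) (a 1) * hilbertSymbol (a 0) (a 2) * hilbertSymbol (a 0) (a 3) *
      (hilbertSymbol (a 1) (a 2) * hilbertSymbol (a 1) (a 3)) * hilbertSymbol (a 2) (a 3) := by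
    have e0 : Finset.Ioi (0 : Fin 4) = {1, 2, 3} := by decide
    have e1 : Finset.Ioi (1 : Fin 4) = {2, 3} := by decide
    have e2 : Finset.Ioi (2 : Fin 4) = {3} := by decide
    have e3 : Finset.Ioi (3 : Fin 4) = ∅ := by decide
    simp [hasseInvariant, Fin.prod_univ_four, e0, e1, e2, e3, mul_assoc]
  rw [key, hs, c3 _ h0, c3 _ h1, c3 _ h2, ← neg_one_mul (a 0 * a 1), ← neg_one_mul (a 2),
    hF.hilbertSymbol_mul_left hm m01 h0, hF.hilbertSymbol_mul_left h0 h1 h0,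
    hF.hilbertSymbol_mul_left hm m01 (mul_ne_zero hm h2),
    hF.hilbertSymbol_mul_left h0 h1 (mul_ne_zero hm h2), hF.hilbertSymbol_mul_right hm hm h2,
    hF.hilbertSymbol_mul_right h0 hm h2, hF.hilbertSymbol_mul_right h1 hm h2,
    hF.hilbertSymbol_self h0, hF.hilbertSymbol_self h1, hF.hilbertSymbol_self h2,
    hilbertSymbol_comm (a 0) (-1), hilbertSymbol_comm (a 1) (-1),
    hilbertSymbol_comm (a 1) (a 0), hilbertSymbol_comm (a 2) (a 1), hilbertSymbol_comm (a 2) (a 0)]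
  generalize hilbertSymbol (-1 : F) (-1) = p
  generalize hilbertSymbol (-1 : F) (a 0) = q0
  generalize hilbertSymbol (-1 : F) (a 1) = q1
  generalize hilbertSymbol (-1 : F) (a 2) = q2
  generalize hilbertSymbol (a 0) (a 1) = r01
  generalize hilbertSymbol (a 0) (a 2) = r02
  generalize hilbertSymbol (a 1) (a 2) = r12
  revert p q0 q1 q2 r01 r02 r12
  decide

/-- If no four-dimensional diagonal subform has nonsquare determinant, then the form is similar to
`⟨1, 1, 1, 1, 1⟩`, which has the zero `(√-7, 2, 1, 1, 1)`. -/
lemma diagIsotropic_five {a : Fin 5 → F} (ha : ∀ i, a i ≠ 0) : DiagIsotropic a := by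
  by_cases h : ∃ i : Fin 5, ¬ IsSquare (diagDet (a ∘ i.succAbove))
  · obtain ⟨i, hi⟩ := h
    exact DiagIsotropic.of_comp (Fin.succAbove_right_injective (p := i))
      (hF.diagIsotropic_four_of_not_isSquare (fun _ => ha _) hi)
  push Not at h
  have hd : ∀ i, IsSquare (diagDet a * a i) := by
    intro i
    have : diagDet a = a i * diagDet (a ∘ i.succAbove) := Fin.prod_univ_succAbove a i
    rw [this, mul_right_comm]
    exact (IsSquare.mul_self (a i)).mul (h i)
  have hd0 : diagDet a ≠ 0 := Finset.prod_ne_zero_iff.mpr fun _ _ => ha _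
  choose m hm using hd
  have hm0 : ∀ i, m i ≠ 0 := by
    intro i h0
    exact mul_ne_zero hd0 (ha i) (by rw [hm, h0, mul_zero])
  obtain ⟨s, hs⟩ := hF.isSquare_neg_seven
  refine ⟨fun i => ![s, 2, 1, 1, 1] i / m i, fun h => ?_, ?_⟩
  · simpa [hm0] using congrFun h 2
  · have hi : ∀ i, a i * (![s, 2, 1, 1, 1] i / m i) ^ 2 =
        (diagDet a)⁻¹ * ![s, 2, 1, 1, 1] i ^ 2 := by
      intro i
      have hmi := hm0 i
      field_simp
      linear_combination (![s, 2, 1, 1, 1] i ^ 2) * hm i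
    simp only [hi, ← Finset.mul_sum]
    simp only [Fin.sum_univ_five, Matrix.cons_val_zero, Matrix.cons_val_one, Matrix.cons_val]
    linear_combination (-(diagDet a)⁻¹) * hs

lemma diagIsotropic_of_five_le {n : ℕ} (hn : 5 ≤ n) {a : Fin n → F} (ha : ∀ i, a i ≠ 0) :
    DiagIsotropic a :=
  DiagIsotropic.of_comp (Fin.castLE_injective hn) (hF.diagIsotropic_five fun _ => ha _)

end HasLocalSymbol

end Field

/-! ### The filtration of the units of a discrete valuation ring -/

section Filtration

open IsLocalRing

variable {O : Type*} [CommRing O]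

lemma pow_dvd_mul_inv_sub_one {π : O} {k : ℕ} {u h : Oˣ} (H : π ^ k ∣ (u : O) - h) :
    π ^ k ∣ ((u * h⁻¹ : Oˣ) : O) - 1 := by
  have : ((u * h⁻¹ : Oˣ) : O) - 1 = ((u : O) - h) * (h⁻¹ : Oˣ) := by
    rw [sub_mul, Units.mul_inv, Units.val_mul]
  rw [this]
  exact H.mul_right _

/-- A subgroup `H` of the units which surjects onto every graded piece `U_i / U_{i+1}` below `N`
but the one at `i₀`, has image of index at most two there, and contains `U_N`, has index at most
two in the unit group. -/
lemma mem_or_mem_or_mul_mem_of_filtration {π : O} (H : Subgroup Oˣ) {N i₀ : ℕ} (hi₀ : i₀ < N)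
    (hN : ∀ u : Oˣ, π ^ N ∣ (u : O) - 1 → u ∈ H)
    (hlev : ∀ i < N, i ≠ i₀ → ∀ u : Oˣ, π ^ i ∣ (u : O) - 1 → ∃ h ∈ H, π ^ (i + 1) ∣ (u : O) - h)
    (hcrit : ∀ u v : Oˣ, π ^ i₀ ∣ (u : O) - 1 → π ^ i₀ ∣ (v : O) - 1 → ∃ h ∈ H,
      π ^ (i₀ + 1) ∣ (u : O) - h ∨ π ^ (i₀ + 1) ∣ (v : O) - h ∨ π ^ (i₀ + 1) ∣ (u * v : O) - h)
    (u v : Oˣ) : u ∈ H ∨ v ∈ H ∨ u * v ∈ H := by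
  have high : ∀ k m, N ≤ m + k → i₀ < m → ∀ u : Oˣ, π ^ m ∣ (u : O) - 1 → u ∈ H := by
    intro k
    induction k with
    | zero => exact fun m hm _ u hu => hN u ((pow_dvd_pow π hm).trans hu)
    | succ k ih =>
      intro m hm hi u hu
      by_cases hmN : N ≤ m
      · exact hN u ((pow_dvd_pow π hmN).trans hu)
      · obtain ⟨h, hh, hd⟩ := hlev m (by omega) (by omega) u hu
        have := ih (m + 1) (by omega) (by omega) _ (pow_dvd_mul_inv_sub_one hd)
        exact (H.mul_mem_cancel_right (H.inv_mem hh)).1 this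
  have top : ∀ u h : Oˣ, h ∈ H → π ^ (i₀ + 1) ∣ (u : O) - h → u ∈ H := fun u h hh hd =>
    (H.mul_mem_cancel_right (H.inv_mem hh)).1
      (high N (i₀ + 1) (by omega) (by omega) _ (pow_dvd_mul_inv_sub_one hd))
  have low : ∀ i ≤ i₀, ∀ u : Oˣ, ∃ h ∈ H, π ^ i ∣ (u : O) - h := by
    intro i
    induction i with
    | zero => exact fun _ u => ⟨1, H.one_mem, by simp⟩
    | succ i ih =>
      intro hi u
      obtain ⟨h, hh, hd⟩ := ih (by omega) u
      obtain ⟨h', hh', hd'⟩ := hlev i (by omega) (by omega) _ (pow_dvd_mul_inv_sub_one hd)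
      refine ⟨h' * h, H.mul_mem hh' hh, ?_⟩
      have : (u : O) - (h' * h : Oˣ) = (((u * h⁻¹ : Oˣ) : O) - h') * h := by
        rw [sub_mul, ← Units.val_mul, ← Units.val_mul, inv_mul_cancel_right]
      rw [this]
      exact hd'.mul_right _
  obtain ⟨g, hg, hgd⟩ := low i₀ le_rfl u
  obtain ⟨h, hh, hhd⟩ := low i₀ le_rfl v
  obtain ⟨r, hr, hc⟩ := hcrit _ _ (pow_dvd_mul_inv_sub_one hgd) (pow_dvd_mul_inv_sub_one hhd)
  rcases hc with hc | hc | hc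
  · exact Or.inl ((H.mul_mem_cancel_right (H.inv_mem hg)).1 (top _ r hr hc))
  · exact Or.inr (Or.inl ((H.mul_mem_cancel_right (H.inv_mem hh)).1 (top _ r hr hc)))
  · refine Or.inr (Or.inr ((H.mul_mem_cancel_right
      (H.mul_mem (H.inv_mem hg) (H.inv_mem hh))).1 (top _ r hr ?_)))
    rwa [mul_mul_mul_comm, Units.val_mul]

end Filtration

/-! ### Residue fields and Hensel's lemma in residue characteristic two -/

section Residue

/-- The additive map `x ↦ p x + q x²` of a finite field of characteristic two has a kernel of order
two, hence an image of index two. -/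
lemma exists_eq_quadratic_or {k : Type*} [Field k] [Finite k] [CharP k 2] {p q : k}
    (hp : p ≠ 0) (hq : q ≠ 0) (s t : k) :
    ∃ x, p * x + q * x ^ 2 = s ∨ p * x + q * x ^ 2 = t ∨ p * x + q * x ^ 2 = s + t := by
  let f : k →+ k :=
    { toFun x := p * x + q * x ^ 2
      map_zero' := by simp
      map_add' x y := by rw [CharTwo.add_sq]; ring }
  have hker : Nat.card f.ker = 2 := by
    have : (f.ker : Set k) = {0, p / q} := by
      ext x
      simp only [SetLike.mem_coe, AddMonoidHom.mem_ker, Set.mem_insert_iff, Set.mem_singleton_iff]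
      change p * x + q * x ^ 2 = 0 ↔ _
      have e : p * x + q * x ^ 2 = x * (p + q * x) := by ring
      rw [e, mul_eq_zero, eq_div_iff hq, mul_comm x q, add_comm p, CharTwo.add_eq_zero]
    rw [← SetLike.coe_sort_coe, this, Nat.card_coe_set_eq, Set.ncard_pair]
    exact (div_ne_zero hp hq).symm
  have hidx : f.range.index = 2 := by
    have h1 := f.range.card_mul_index
    have h2 := f.ker.card_mul_index
    rw [AddSubgroup.index_ker, hker] at h2
    have h3 : 0 < Nat.card f.range := Nat.card_pos
    have : Nat.card f.range * f.range.index = Nat.card f.range * 2 := by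
      rw [h1, ← h2]
      ring
    exact Nat.eq_of_mul_eq_mul_left h3 this
  have hst := AddSubgroup.add_mem_iff_of_index_two hidx (a := s) (b := t)
  by_cases hs : s ∈ f.range
  · obtain ⟨x, hx⟩ := hs
    exact ⟨x, Or.inl hx⟩
  by_cases ht : t ∈ f.range
  · obtain ⟨x, hx⟩ := ht
    exact ⟨x, Or.inr (Or.inl hx)⟩
  · obtain ⟨x, hx⟩ := hst.2 (by tauto)
    exact ⟨x, Or.inr (Or.inr hx)⟩

/-- The Artin-Schreier map of a finite field of characteristic two is not surjective. -/
lemma exists_sq_add_self_ne {k : Type*} [Field k] [Finite k] [CharP k 2] :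
    ∃ r : k, ∀ t : k, t ^ 2 + t ≠ r := by
  by_contra! h
  have hinj := Finite.injective_iff_surjective.2
    (show Function.Surjective fun t : k => t ^ 2 + t from h)
  have : (0 : k) = 1 := hinj (by simp [one_add_one_eq_two, CharTwo.two_eq_zero])
  exact zero_ne_one this

open IsLocalRing

variable {O : Type*} [CommRing O]

lemma exists_sq_add_self_eq [HenselianLocalRing O] {c : O} (hc : c ∈ maximalIdeal O) :
    ∃ y, y ^ 2 + y = c := by
  open Polynomial in
  obtain ⟨y, hy, -⟩ := HenselianLocalRing.is_henselian (X ^ 2 + X - C c : O[X]) (by monicity!) 0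
    (by simpa using hc) (by simp)
  exact ⟨y, by
    rw [Polynomial.IsRoot.def] at hy
    simp only [Polynomial.eval_sub, Polynomial.eval_add, Polynomial.eval_pow, Polynomial.eval_X,
      Polynomial.eval_C] at hy
    linear_combination hy⟩

lemma isSquare_one_add_four_mul [HenselianLocalRing O] (h2 : (2 : O) ∈ maximalIdeal O) {γ t : O}
    (h : t ^ 2 + t - γ ∈ maximalIdeal O) : IsSquare (1 + 4 * γ) := by
  have hu : IsUnit (1 + 2 * t) := by
    by_contra hn
    have h1 := (maximalIdeal O).sub_mem ((mem_maximalIdeal _).2 hn) (Ideal.mul_mem_right t _ h2)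
    rw [add_sub_cancel_right] at h1
    exact (mem_maximalIdeal _).1 h1 isUnit_one
  obtain ⟨m, hm⟩ := hu
  have hmm : (m : O) * (m⁻¹ : Oˣ) = 1 := m.mul_inv
  -- Substituting `y = t + (1 + 2t) z` in `y² + y = γ` normalises the linear coefficient.
  obtain ⟨z, hz⟩ := exists_sq_add_self_eq
    ((maximalIdeal O).mul_mem_right (-((m⁻¹ : Oˣ) : O) ^ 2) h)
  refine ⟨1 + 2 * (t + m * z), ?_⟩
  have : (m : O) ^ 2 * (z ^ 2 + z) = -(t ^ 2 + t - γ) := by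
    rw [hz]
    linear_combination (-(t ^ 2 + t - γ) * (m * (m⁻¹ : Oˣ) + 1)) * hmm
  rw [hm] at this ⊢
  linear_combination (-4) * this

lemma isSquare_neg_seven [HenselianLocalRing O] (h2 : (2 : O) ∈ maximalIdeal O) :
    IsSquare (-7 : O) := by
  have := isSquare_one_add_four_mul h2 (γ := -2) (t := 0) (by simpa using h2)
  convert this using 1
  norm_num

variable [IsLocalRing O]

lemma dvd_iff_residue_eq_zero {π : O} (hπ : maximalIdeal O = Ideal.span {π}) (x : O) :
    π ∣ x ↔ residue O x = 0 := by
  rw [residue_eq_zero_iff, hπ, Ideal.mem_span_singleton]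

lemma charP_residueField (h2 : (2 : O) ∈ maximalIdeal O) : CharP (ResidueField O) 2 := by
  have h : (2 : ResidueField O) = 0 := by
    rw [← map_ofNat (residue O) 2]
    exact (residue_eq_zero_iff _).2 h2
  exact CharTwo.of_one_ne_zero_of_two_eq_zero one_ne_zero h

variable [Finite (ResidueField O)]

lemma exists_dvd_sub_mul_sq {π : O} (hπ : maximalIdeal O = Ideal.span {π})
    (h2 : (2 : O) ∈ maximalIdeal O) (ε : Oˣ) (x : O) : ∃ s, π ∣ x - ε * s ^ 2 := by
  have := charP_residueField h2
  have := Fintype.ofFinite (ResidueField O)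
  obtain ⟨r, hr⟩ := FiniteField.isSquare_of_char_two (ringChar.eq (ResidueField O) 2)
    (residue O (x * (ε⁻¹ : Oˣ)))
  obtain ⟨s, rfl⟩ := residue_surjective r
  refine ⟨s, ?_⟩
  have h : π ∣ x * (ε⁻¹ : Oˣ) - s * s := by
    rw [dvd_iff_residue_eq_zero hπ, map_sub, hr, map_mul, sub_self]
  have e : x - ε * s ^ 2 = ε * (x * (ε⁻¹ : Oˣ) - s * s) := by
    linear_combination (-x) * ε.mul_inv
  rw [e]
  exact h.mul_left _

lemma exists_dvd_sub_quadratic {π : O} (hπ : maximalIdeal O = Ideal.span {π})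
    (h2 : (2 : O) ∈ maximalIdeal O) (p q : Oˣ) (x y : O) :
    ∃ s : O, π ∣ x - (p * s + q * s ^ 2) ∨ π ∣ y - (p * s + q * s ^ 2) ∨
      π ∣ x + y - (p * s + q * s ^ 2) := by
  have := charP_residueField h2
  have hp := (p.isUnit.map (residue O)).ne_zero
  have hq := (q.isUnit.map (residue O)).ne_zero
  obtain ⟨r, hr⟩ := exists_eq_quadratic_or hp hq (residue O x) (residue O y)
  obtain ⟨s, rfl⟩ := residue_surjective r
  refine ⟨s, ?_⟩
  simp only [dvd_iff_residue_eq_zero hπ, map_sub, map_add, map_mul, map_pow]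
  rcases hr with hr | hr | hr <;> simp [hr]

lemma exists_forall_isUnit_sq_add_self_sub (h2 : (2 : O) ∈ maximalIdeal O) :
    ∃ ρ : O, ∀ t : O, IsUnit (t ^ 2 + t - ρ) := by
  have := charP_residueField h2
  obtain ⟨r, hr⟩ := exists_sq_add_self_ne (k := ResidueField O)
  obtain ⟨ρ, rfl⟩ := residue_surjective r
  refine ⟨ρ, fun t => ?_⟩
  by_contra hn
  have := (residue_eq_zero_iff _).2 ((mem_maximalIdeal _).2 hn)
  rw [map_sub, map_add, map_pow, sub_eq_zero] at this
  exact hr _ this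

end Residue

/-! ### Norm groups over a dyadic local field -/

section Local

open IsLocalRing

variable {O : Type*} [CommRing O]

/-- Units of `O` that are values of `x² - a y²` over `F`. -/
def normUnits (O : Type*) [CommRing O] {F : Type*} [Field F] [Algebra O F] (a : F) :
    Subgroup Oˣ where
  carrier := {u | IsNorm a (algebraMap O F u)}
  one_mem' := by simpa using IsNorm.sq a 1
  mul_mem' hu hv := by simpa using IsNorm.mul hu hv
  inv_mem' {u} hu := by
    have e : algebraMap O F (u⁻¹ : Oˣ) = (algebraMap O F u)⁻¹ := by
      refine eq_inv_of_mul_eq_one_left ?_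
      rw [← map_mul, Units.inv_mul, map_one]
    change IsNorm a _
    rw [e]
    exact IsNorm.inv hu

lemma isUnit_of_dvd_unit_sub [IsLocalRing O] {π w : O} (hπ : π ∈ maximalIdeal O) {i : ℕ} {u : Oˣ}
    (h : π ^ (i + 1) ∣ (u : O) - w) : IsUnit w := by
  by_contra hw
  have h1 : (u : O) - w ∈ maximalIdeal O :=
    Ideal.mem_of_dvd _ ((dvd_pow_self π i.succ_ne_zero).trans h) hπ
  have h2 := (maximalIdeal O).add_mem h1 ((mem_maximalIdeal _).2 hw)
  rw [sub_add_cancel] at h2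
  exact (mem_maximalIdeal _).1 h2 u.isUnit

variable {F : Type*} [Field F] [Algebra O F]

lemma exists_mem_normUnits [IsLocalRing O] {π w : O} (hπ : π ∈ maximalIdeal O) {a : F} {i : ℕ}
    {u : Oˣ} (hw : IsNorm a (algebraMap O F w)) (h : π ^ (i + 1) ∣ (u : O) - w) :
    ∃ h ∈ normUnits O a, π ^ (i + 1) ∣ (u : O) - h := by
  obtain ⟨w, rfl⟩ := isUnit_of_dvd_unit_sub hπ h
  exact ⟨w, hw, h⟩

variable [IsLocalRing O] [Finite (ResidueField O)] {π : O} {η : Oˣ} {e : ℕ}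

lemma exists_dvd_sub_one_add_sq (hπ : maximalIdeal O = Ideal.span {π}) (h2 : (2 : O) = η * π ^ e)
    (he : 0 < e) {j : ℕ} (hj : j < e) {u : Oˣ} (hu : π ^ (2 * j) ∣ (u : O) - 1) :
    ∃ s : O, π ^ (2 * j + 1) ∣ (u : O) - (1 + π ^ j * s) ^ 2 := by
  have h2m : (2 : O) ∈ maximalIdeal O := by
    rw [h2, hπ, Ideal.mem_span_singleton]
    exact (dvd_pow_self π he.ne').mul_left _
  obtain ⟨x, hx⟩ := hu
  obtain ⟨s, y, hs⟩ := exists_dvd_sub_mul_sq hπ h2m 1 x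
  obtain ⟨k, rfl⟩ := Nat.exists_eq_add_of_lt hj
  refine ⟨s, y - η * π ^ k * s, ?_⟩
  rw [Units.val_one, one_mul] at hs
  linear_combination hx + π ^ (2 * j) * hs - π ^ j * s * h2

/-- Squares have index two at the level of `4`. -/
lemma exists_dvd_sub_one_add_sq_or (hπ : maximalIdeal O = Ideal.span {π})
    (h2 : (2 : O) = η * π ^ e) (he : 0 < e) {u v : Oˣ} (hu : π ^ (2 * e) ∣ (u : O) - 1)
    (hv : π ^ (2 * e) ∣ (v : O) - 1) :
    ∃ s : O, π ^ (2 * e + 1) ∣ (u : O) - (1 + π ^ e * s) ^ 2 ∨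
      π ^ (2 * e + 1) ∣ (v : O) - (1 + π ^ e * s) ^ 2 ∨
      π ^ (2 * e + 1) ∣ (u * v : O) - (1 + π ^ e * s) ^ 2 := by
  have h2m : (2 : O) ∈ maximalIdeal O := by
    rw [h2, hπ, Ideal.mem_span_singleton]
    exact (dvd_pow_self π he.ne').mul_left _
  obtain ⟨x, hx⟩ := hu
  obtain ⟨y, hy⟩ := hv
  obtain ⟨k, rfl⟩ := Nat.exists_eq_add_of_lt he
  obtain ⟨s, ⟨z, hz⟩ | ⟨z, hz⟩ | ⟨z, hz⟩⟩ := exists_dvd_sub_quadratic hπ h2m η 1 x y <;>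
    rw [Units.val_one, one_mul] at hz <;> refine ⟨s, ?_⟩
  · refine Or.inl ⟨z, ?_⟩
    linear_combination hx + π ^ (2 * (0 + k + 1)) * hz - π ^ (0 + k + 1) * s * h2
  · refine Or.inr (Or.inl ⟨z, ?_⟩)
    linear_combination hy + π ^ (2 * (0 + k + 1)) * hz - π ^ (0 + k + 1) * s * h2
  · refine Or.inr (Or.inr ⟨z + π ^ (2 * k + 1) * x * y, ?_⟩)
    linear_combination v * hx + hy + π ^ (2 * (0 + k + 1)) * x * hy +
      π ^ (2 * (0 + k + 1)) * hz - π ^ (0 + k + 1) * s * h2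

end Local

section Henselian

open IsLocalRing

variable {O F : Type*} [CommRing O] [HenselianLocalRing O] [Field F] [Algebra O F]
  {π : O} {η : Oˣ} {e : ℕ}

lemma isSquare_of_pow_dvd_sub_one (hπ : maximalIdeal O = Ideal.span {π})
    (h2 : (2 : O) = η * π ^ e) (he : 0 < e) {u : Oˣ} (hu : π ^ (2 * e + 1) ∣ (u : O) - 1) :
    IsSquare (u : O) := by
  have h2m : (2 : O) ∈ maximalIdeal O := by
    rw [h2, hπ, Ideal.mem_span_singleton]
    exact (dvd_pow_self π he.ne').mul_left _
  obtain ⟨x, hx⟩ := hu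
  have h := isSquare_one_add_four_mul h2m (γ := π * ((η⁻¹ : Oˣ) ^ 2 * x)) (t := 0) (by
    rw [hπ, Ideal.mem_span_singleton]
    exact ⟨-((η⁻¹ : Oˣ) ^ 2 * x), by ring⟩)
  convert h using 1
  have hη : (η : O) * (η⁻¹ : Oˣ) = 1 := η.mul_inv
  linear_combination hx - π * (η⁻¹ : Oˣ) ^ 2 * x * (2 + η * π ^ e) * h2 -
    π ^ (2 * e + 1) * x * (η * (η⁻¹ : Oˣ) + 1) * hη

lemma mem_normUnits_of_pow_dvd_sub_one (hπ : maximalIdeal O = Ideal.span {π})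
    (h2 : (2 : O) = η * π ^ e) (he : 0 < e) (a : F) {u : Oˣ}
    (hu : π ^ (2 * e + 1) ∣ (u : O) - 1) : u ∈ normUnits O a := by
  obtain ⟨r, hr⟩ := isSquare_of_pow_dvd_sub_one hπ h2 he hu
  change IsNorm a (algebraMap O F u)
  rw [hr, ← sq, map_pow]
  exact IsNorm.sq a _

variable [Finite (ResidueField O)]

/-- The norm group of `F(√(πε))` contains the squares, which fill the even levels below `4`, and
the elements `1 - πε z²`, which fill the odd levels. -/
lemma normUnits_index_of_prime (hπ : maximalIdeal O = Ideal.span {π})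
    (h2 : (2 : O) = η * π ^ e) (he : 0 < e) (ε u v : Oˣ) :
    u ∈ normUnits O (algebraMap O F (π * ε)) ∨ v ∈ normUnits O (algebraMap O F (π * ε)) ∨
      u * v ∈ normUnits O (algebraMap O F (π * ε)) := by
  have h2m : (2 : O) ∈ maximalIdeal O := by
    rw [h2, hπ, Ideal.mem_span_singleton]
    exact (dvd_pow_self π he.ne').mul_left _
  have hπm : π ∈ maximalIdeal O := hπ ▸ Ideal.mem_span_singleton_self π
  have sq_norm : ∀ w : O, IsNorm (algebraMap O F (π * ε)) (algebraMap O F (w ^ 2)) := by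
    intro w
    rw [map_pow]
    exact IsNorm.sq _ _
  refine mem_or_mem_or_mul_mem_of_filtration (π := π) _ (i₀ := 2 * e) (N := 2 * e + 1) (by omega)
    (fun u hu => mem_normUnits_of_pow_dvd_sub_one hπ h2 he _ hu) ?_ ?_ u v
  · intro i hi hne u hu
    obtain ⟨j, rfl | rfl⟩ := Nat.even_or_odd' i
    · obtain ⟨s, hs⟩ := exists_dvd_sub_one_add_sq hπ h2 he (by omega) hu
      exact exists_mem_normUnits hπm (sq_norm _) hs
    · obtain ⟨x, hx⟩ := hu
      obtain ⟨s, y, hs⟩ := exists_dvd_sub_mul_sq hπ h2m (-ε) x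
      refine exists_mem_normUnits (w := 1 - π * ε * (π ^ j * s) ^ 2) hπm
        ⟨1, algebraMap O F (π ^ j * s), by simp⟩ ⟨y, ?_⟩
      rw [Units.val_neg] at hs
      linear_combination hx + π ^ (2 * j + 1) * hs
  · intro u v hu hv
    obtain ⟨s, hs | hs | hs⟩ := exists_dvd_sub_one_add_sq_or hπ h2 he hu hv
    · obtain ⟨h, hh, hd⟩ := exists_mem_normUnits hπm (sq_norm _) hs
      exact ⟨h, hh, Or.inl hd⟩
    · obtain ⟨h, hh, hd⟩ := exists_mem_normUnits hπm (sq_norm _) hs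
      exact ⟨h, hh, Or.inr (Or.inl hd)⟩
    · rw [← Units.val_mul] at hs
      obtain ⟨h, hh, hd⟩ := exists_mem_normUnits hπm (sq_norm _) hs
      exact ⟨h, hh, Or.inr (Or.inr (by rwa [Units.val_mul] at hd))⟩

/-- For `a = 1 + π^{2d+1} ε` with `2d + 1` less than the valuation `2e` of `4`, the elements
`(1 + z)² - a z² = 1 + 2z - (a - 1) z²` fill the levels that squares do not, except the one at
which the two terms in `z` have the same valuation. There, with `e = d + g + 1`, the level is
`2g + 1` and the image has index two. -/
lemma normUnits_index_of_unit [FaithfulSMul O F] {d g : ℕ}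
    (hπ : maximalIdeal O = Ideal.span {π}) (hπ0 : π ≠ 0)
    (h2 : (2 : O) = η * π ^ (d + g + 1)) (ε u v : Oˣ) :
    u ∈ normUnits O (algebraMap O F (1 + π ^ (2 * d + 1) * ε)) ∨
      v ∈ normUnits O (algebraMap O F (1 + π ^ (2 * d + 1) * ε)) ∨
      u * v ∈ normUnits O (algebraMap O F (1 + π ^ (2 * d + 1) * ε)) := by
  have he : 0 < d + g + 1 := by omega
  have h2m : (2 : O) ∈ maximalIdeal O := by
    rw [h2, hπ, Ideal.mem_span_singleton]
    exact (dvd_pow_self π he.ne').mul_left _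
  have hπm : π ∈ maximalIdeal O := hπ ▸ Ideal.mem_span_singleton_self π
  have hπF : algebraMap O F π ≠ 0 :=
    (map_ne_zero_iff _ (FaithfulSMul.algebraMap_injective O F)).2 hπ0
  have h2F := congrArg (algebraMap O F) h2
  simp only [map_ofNat, map_mul, map_pow] at h2F
  have norm : ∀ (j : ℕ) (s : O), IsNorm (algebraMap O F (1 + π ^ (2 * d + 1) * ε))
      (algebraMap O F (1 + η * s * π ^ (g + 1 + j) - ε * s ^ 2 * π ^ (2 * j + 1))) := by
    intro j s
    -- The case of `z = π^j s / π^d`.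
    refine ⟨1 + algebraMap O F (π ^ j * s) / algebraMap O F π ^ d,
      algebraMap O F (π ^ j * s) / algebraMap O F π ^ d, ?_⟩
    simp only [map_add, map_sub, map_mul, map_pow, map_one]
    field_simp
    linear_combination (-(algebraMap O F π) ^ (d + j) * algebraMap O F s) * h2F
  have sq_norm : ∀ w : O, IsNorm (algebraMap O F (1 + π ^ (2 * d + 1) * ε))
      (algebraMap O F (w ^ 2)) := by
    intro w
    rw [map_pow]
    exact IsNorm.sq _ _
  refine mem_or_mem_or_mul_mem_of_filtration (π := π) _ (i₀ := 2 * g + 1)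
    (N := 2 * (d + g + 1) + 1) (by omega)
    (fun u hu => mem_normUnits_of_pow_dvd_sub_one hπ h2 he _ hu) ?_ ?_ u v
  · intro i hi hne u hu
    by_cases hig : 2 * g + 1 < i
    · -- The linear term dominates.
      obtain ⟨k, rfl⟩ := Nat.exists_eq_add_of_lt hig
      obtain ⟨x, hx⟩ := hu
      refine exists_mem_normUnits hπm (norm (g + 1 + k) ((η⁻¹ : Oˣ) * x))
        ⟨ε * ((η⁻¹ : Oˣ) * x) ^ 2 * π ^ k, ?_⟩
      linear_combination hx - π ^ (2 * g + 1 + k + 1) * x * η.mul_inv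
    · obtain ⟨j, rfl | rfl⟩ := Nat.even_or_odd' i
      · obtain ⟨s, hs⟩ := exists_dvd_sub_one_add_sq hπ h2 he (by omega) hu
        exact exists_mem_normUnits hπm (sq_norm _) hs
      · -- The quadratic term dominates.
        obtain ⟨k, rfl⟩ := Nat.exists_eq_add_of_lt (show j < g by omega)
        obtain ⟨x, hx⟩ := hu
        obtain ⟨s, y, hs⟩ := exists_dvd_sub_mul_sq hπ h2m (-ε) x
        refine exists_mem_normUnits hπm (norm j s) ⟨y - η * s * π ^ k, ?_⟩
        rw [Units.val_neg] at hs
        linear_combination hx + π ^ (2 * j + 1) * hs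
  · rintro u v ⟨x, hx⟩ ⟨y, hy⟩
    obtain ⟨s, ⟨z, hz⟩ | ⟨z, hz⟩ | ⟨z, hz⟩⟩ := exists_dvd_sub_quadratic hπ h2m η (-ε) x y <;>
      rw [Units.val_neg] at hz
    · obtain ⟨h, hh, hd⟩ := exists_mem_normUnits (u := u) (i := 2 * g + 1) hπm (norm g s)
        ⟨z, by linear_combination hx + π ^ (2 * g + 1) * hz⟩
      exact ⟨h, hh, Or.inl hd⟩
    · obtain ⟨h, hh, hd⟩ := exists_mem_normUnits (u := v) (i := 2 * g + 1) hπm (norm g s)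
        ⟨z, by linear_combination hy + π ^ (2 * g + 1) * hz⟩
      exact ⟨h, hh, Or.inr (Or.inl hd)⟩
    · obtain ⟨h, hh, hd⟩ := exists_mem_normUnits (u := u * v) (i := 2 * g + 1) hπm (norm g s)
        ⟨z + π ^ (2 * g) * x * y, by
          rw [Units.val_mul]
          linear_combination v * hx + hy + π ^ (2 * g + 1) * x * hy + π ^ (2 * g + 1) * hz⟩
      exact ⟨h, hh, Or.inr (Or.inr (by rwa [Units.val_mul] at hd))⟩

end Henselian

/-! ### The Hilbert symbol of a dyadic local field -/

section DiscreteValuationRing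

open IsLocalRing

variable {O F : Type*} [CommRing O] [IsDomain O] [IsDiscreteValuationRing O]
  [Field F] [Algebra O F] [IsFractionRing O F] {π : O}

lemma exists_eq_unit_mul_sq (hπ : Irreducible π) {b : F} (hb : b ≠ 0) :
    ∃ (u : Oˣ) (s : F), s ≠ 0 ∧
      (b = algebraMap O F u * s ^ 2 ∨ b = algebraMap O F (π * u) * s ^ 2) := by
  obtain ⟨n, m, hm, rfl⟩ := IsFractionRing.div_surjective (A := O) b
  have hm0 : algebraMap O F m ≠ 0 := fun h => hb (by rw [h, div_zero])
  have hn0 : algebraMap O F n ≠ 0 := fun h => hb (by rw [h, zero_div])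
  have hnm : n * m ≠ 0 := by
    intro h
    have := congrArg (algebraMap O F) h
    simp [hm0, hn0] at this
  have hπF : algebraMap O F π ≠ 0 :=
    (map_ne_zero_iff _ (FaithfulSMul.algebraMap_injective O F)).2 hπ.ne_zero
  obtain ⟨k, u, hk⟩ := IsDiscreteValuationRing.eq_unit_mul_pow_irreducible hnm hπ
  have hk' := congrArg (algebraMap O F) hk
  simp only [map_mul, map_pow] at hk'
  obtain ⟨j, rfl | rfl⟩ := Nat.even_or_odd' k
  · refine ⟨u, algebraMap O F π ^ j / algebraMap O F m, by positivity, Or.inl ?_⟩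
    field_simp
    rw [hk']
    ring
  · refine ⟨u, algebraMap O F π ^ j / algebraMap O F m, by positivity, Or.inr ?_⟩
    rw [map_mul]
    field_simp
    rw [hk']
    ring

lemma prime_mul_unit_ne_unit_mul_sq (hπ : Irreducible π) (u w : Oˣ) (c : F) :
    algebraMap O F (π * u) ≠ algebraMap O F w * c ^ 2 := by
  intro h
  have hc : c ^ 2 = algebraMap O F (π * (u * (w⁻¹ : Oˣ))) := by
    have hw : algebraMap O F w * algebraMap O F (w⁻¹ : Oˣ) = 1 := by
      rw [← map_mul, Units.mul_inv, map_one]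
    rw [← mul_assoc, map_mul, h]
    linear_combination (-c ^ 2) * hw
  obtain ⟨d, rfl⟩ := IsIntegrallyClosed.exists_algebraMap_eq_of_isIntegral_pow (R := O) (x := c)
    two_pos (hc ▸ isIntegral_algebraMap)
  have hd : d ^ 2 = π * (u * (w⁻¹ : Oˣ)) :=
    FaithfulSMul.algebraMap_injective O F (by rw [map_pow, hc])
  obtain ⟨k, rfl⟩ := hπ.prime.dvd_of_dvd_pow (Dvd.intro _ hd.symm)
  have hk : π * k ^ 2 = ((u * w⁻¹ : Oˣ) : O) :=
    mul_left_cancel₀ hπ.ne_zero (by rw [Units.val_mul, ← hd]; ring)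
  exact hπ.not_isUnit (isUnit_of_mul_isUnit_left (hk ▸ (u * w⁻¹).isUnit))

/-- The norm form of the unramified quadratic extension takes only values of even valuation: after
scaling, `X² + XY - γY²` is anisotropic modulo the maximal ideal. -/
lemma exists_eq_unit_mul_sq_of_unramified {γ : O} (hγ : ∀ t : O, IsUnit (t ^ 2 + t - γ))
    (X Y : F) :
    ∃ (w : Oˣ) (c : F), X ^ 2 + X * Y - algebraMap O F γ * Y ^ 2 = algebraMap O F w * c ^ 2 := by
  by_cases hY : Y = 0
  · exact ⟨1, X, by simp [hY]⟩
  by_cases hX : X = 0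
  · obtain ⟨w, hw⟩ := hγ 0
    refine ⟨w, Y, ?_⟩
    rw [hw, hX]
    simp only [map_sub, map_add, map_pow, map_zero]
    ring
  rcases ValuationRing.isInteger_or_isInteger O (X / Y) with ⟨r, hr⟩ | ⟨r, hr⟩
  · obtain ⟨w, hw⟩ := hγ r
    refine ⟨w, Y, ?_⟩
    rw [hw]
    simp only [map_sub, map_add, map_pow, hr]
    field_simp
  · have hu : IsUnit (1 + r - γ * r ^ 2) := by
      by_contra hn
      have hn' := (mem_maximalIdeal _).2 hn
      by_cases hrm : r ∈ maximalIdeal O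
      · have h1 := (maximalIdeal O).sub_mem hn' (Ideal.mul_mem_left _ (1 - γ * r) hrm)
        have e : 1 + r - γ * r ^ 2 - (1 - γ * r) * r = 1 := by ring
        rw [e] at h1
        exact (mem_maximalIdeal _).1 h1 isUnit_one
      · obtain ⟨r, rfl⟩ := not_not.1 ((mem_maximalIdeal _).not.1 hrm)
        have h1 := Ideal.mul_mem_left _ ((r⁻¹ : Oˣ) ^ 2 : O) hn'
        have e : ((r⁻¹ : Oˣ) ^ 2 : O) * (1 + r - γ * r ^ 2) =
            ((r⁻¹ : Oˣ) : O) ^ 2 + (r⁻¹ : Oˣ) - γ := by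
          linear_combination ((r⁻¹ : Oˣ) - γ * (r * (r⁻¹ : Oˣ) + 1)) * r.mul_inv
        rw [e] at h1
        exact (mem_maximalIdeal _).1 h1 (hγ _)
    obtain ⟨w, hw⟩ := hu
    refine ⟨w, X, ?_⟩
    rw [hw]
    simp only [map_sub, map_add, map_pow, map_mul, map_one, hr]
    field_simp

lemma not_isNorm_of_unramified (hπ : Irreducible π) {γ : O}
    (hγ : ∀ t : O, IsUnit (t ^ 2 + t - γ)) (u : Oˣ) :
    ¬ IsNorm (algebraMap O F (1 + 4 * γ)) (algebraMap O F (π * u)) := by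
  rintro ⟨x, y, h⟩
  obtain ⟨w, c, hw⟩ := exists_eq_unit_mul_sq_of_unramified hγ (x - y) (2 * y)
  refine prime_mul_unit_ne_unit_mul_sq hπ u w c ?_
  rw [h, ← hw]
  simp only [map_add, map_mul, map_one, map_ofNat]
  ring

/-- Index at most two for the norms among the units gives the same for the full norm group, as soon
as some norm has odd valuation. -/
lemma isNorm_index_of_normUnits_index (hπ : Irreducible π) {a : F} {u₀ : Oˣ}
    (h₀ : IsNorm a (algebraMap O F (π * u₀)))
    (h : ∀ u v : Oˣ, u ∈ normUnits O a ∨ v ∈ normUnits O a ∨ u * v ∈ normUnits O a)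
    {b c : F} (hb : b ≠ 0) (hc : c ≠ 0) : IsNorm a b ∨ IsNorm a c ∨ IsNorm a (b * c) := by
  have key : ∀ b : F, b ≠ 0 → ∃ (u : Oˣ) (g : F), IsNorm a g ∧ b = algebraMap O F u * g := by
    intro b hb
    obtain ⟨u, s, hs, rfl | rfl⟩ := exists_eq_unit_mul_sq hπ hb
    · exact ⟨u, s ^ 2, IsNorm.sq a s, rfl⟩
    · refine ⟨u * u₀⁻¹, _, h₀.mul (IsNorm.sq a s), ?_⟩
      rw [← mul_assoc, ← map_mul]
      congr 2
      rw [Units.val_mul]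
      linear_combination (-π * u) * u₀.inv_mul
  obtain ⟨u, g, hg, rfl⟩ := key b hb
  obtain ⟨v, k, hk, rfl⟩ := key c hc
  rcases h u v with h | h | h
  · exact Or.inl (IsNorm.mul h hg)
  · exact Or.inr (Or.inl (IsNorm.mul h hk))
  · have h' : IsNorm a (algebraMap O F (u * v : Oˣ)) := h
    rw [Units.val_mul, map_mul] at h'
    rw [mul_mul_mul_comm]
    exact Or.inr (Or.inr (h'.mul (hg.mul hk)))

variable [HenselianLocalRing O] [Finite (ResidueField O)]

/-- Units are norms from the unramified quadratic extension: modulo the maximal ideal a unit is a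
square `s²`, so `X² + XY - γY²` takes its value at `(s, 0)`, and the derivative in `Y` there is
the unit `s`. -/
lemma isNorm_unit_of_unramified [NeZero (2 : F)] (h2 : (2 : O) ∈ maximalIdeal O) {γ : O}
    (hγ : ∀ t : O, IsUnit (t ^ 2 + t - γ)) (u : Oˣ) :
    IsNorm (algebraMap O F (1 + 4 * γ)) (algebraMap O F u) := by
  obtain ⟨π, hπ⟩ := IsDiscreteValuationRing.exists_irreducible O
  obtain ⟨s, hs⟩ := exists_dvd_sub_mul_sq hπ.maximalIdeal_eq h2 1 (u : O)
  have hπm : π ∈ maximalIdeal O := hπ.maximalIdeal_eq ▸ Ideal.mem_span_singleton_self π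
  rw [Units.val_one, one_mul] at hs
  have hsq : IsUnit (s ^ 2) := isUnit_of_dvd_unit_sub (i := 0) hπm (by simpa using hs)
  obtain ⟨s, rfl⟩ := (isUnit_pow_iff two_ne_zero).1 hsq
  obtain ⟨g, hg⟩ := hγ 0
  have hg' : (g : O) = -γ := by rw [hg]; ring
  obtain ⟨z, hz⟩ := exists_sq_add_self_eq (O := O) (c := (u - s ^ 2) * (g * (s⁻¹ : Oˣ) ^ 2))
    (Ideal.mul_mem_right _ _ (Ideal.mem_of_dvd _ hs hπm))
  -- `(X, Y) = (s, -sz/γ)` solves `X² + XY - γY² = u`.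
  have hmain : (s : O) ^ 2 + s * (s * (g⁻¹ : Oˣ) * z) - γ * (s * (g⁻¹ : Oˣ) * z) ^ 2 = u := by
    linear_combination ((s : O) ^ 2 * (g⁻¹ : Oˣ)) * hz + (s ^ 2 * (g⁻¹ : Oˣ) * z ^ 2) * g.mul_inv +
      (u - s ^ 2) * (s ^ 2 * (s⁻¹ : Oˣ) ^ 2 * g.mul_inv + (s * (s⁻¹ : Oˣ) + 1) * s.mul_inv) -
      (s * (g⁻¹ : Oˣ) * z) ^ 2 * hg'
  have hF := congrArg (algebraMap O F) hmain
  have h2 : (2 : F) ≠ 0 := NeZero.ne 2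
  refine ⟨algebraMap O F s + algebraMap O F (s * (g⁻¹ : Oˣ) * z) / 2,
    algebraMap O F (s * (g⁻¹ : Oˣ) * z) / 2, ?_⟩
  rw [← hF]
  simp only [map_sub, map_add, map_mul, map_pow, map_one, map_ofNat]
  field_simp
  ring

/-- Every unit is, up to the square of a unit, of the form `1 + π^{2d+1} ε` with `2d + 1` less than
the valuation `2e` of `4`, or of the form `1 + 4γ`: multiplying by squares improves `u - 1` as long
as its valuation is even and less than `2e`. -/
lemma exists_unit_mul_sq_eq (hπ : Irreducible π) {η : Oˣ} {e : ℕ} (he : 0 < e)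
    (h2 : (2 : O) = η * π ^ e) (u : Oˣ) :
    (∃ (s ε : Oˣ) (d : ℕ), d < e ∧ (u * s ^ 2 : O) = 1 + π ^ (2 * d + 1) * ε) ∨
      ∃ (s : Oˣ) (γ : O), (u * s ^ 2 : O) = 1 + 4 * γ := by
  by_cases hA : ∃ (s ε : Oˣ) (d : ℕ), d < e ∧ (u * s ^ 2 : O) = 1 + π ^ (2 * d + 1) * ε
  · exact Or.inl hA
  right
  have hπm : π ∈ maximalIdeal O := hπ.maximalIdeal_eq ▸ Ideal.mem_span_singleton_self π
  have step : ∀ i ≤ 2 * e, ∃ s : Oˣ, π ^ i ∣ ((u * s ^ 2 : Oˣ) : O) - 1 := by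
    intro i
    induction i with
    | zero => exact fun _ => ⟨1, by simp⟩
    | succ i ih =>
      intro hi
      obtain ⟨s, hs⟩ := ih (by omega)
      obtain ⟨j, rfl | rfl⟩ := Nat.even_or_odd' i
      · obtain ⟨r, hr⟩ := exists_dvd_sub_one_add_sq hπ.maximalIdeal_eq h2 he (by omega) hs
        obtain ⟨w, hw⟩ := (isUnit_pow_iff two_ne_zero).1 (isUnit_of_dvd_unit_sub hπm hr)
        rw [← hw, ← Units.val_pow_eq_pow_val] at hr
        refine ⟨s * w⁻¹, ?_⟩
        have := pow_dvd_mul_inv_sub_one hr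
        rwa [mul_assoc, ← inv_pow, ← mul_pow] at this
      · obtain ⟨x, hx⟩ := hs
        by_cases hxu : IsUnit x
        · obtain ⟨ε, rfl⟩ := hxu
          refine absurd ⟨s, ε, j, by omega, ?_⟩ hA
          rw [← hx]
          push_cast
          ring
        · refine ⟨s, ?_⟩
          have hxm : π ∣ x := by
            rw [← Ideal.mem_span_singleton, ← hπ.maximalIdeal_eq]
            exact (mem_maximalIdeal _).2 hxu
          rw [hx, pow_succ _ (2 * j + 1)]
          exact mul_dvd_mul_left _ hxm
  obtain ⟨s, x, hx⟩ := step (2 * e) le_rfl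
  refine ⟨s, (η⁻¹ : Oˣ) ^ 2 * x, ?_⟩
  push_cast at hx
  have hη : (η : O) * (η⁻¹ : Oˣ) = 1 := η.mul_inv
  linear_combination hx - (η⁻¹ : Oˣ) ^ 2 * x * (2 + η * π ^ e) * h2 -
    π ^ (2 * e) * x * (η * (η⁻¹ : Oˣ) + 1) * hη

/-- Square classes of a dyadic local field: besides the trivial one, there are those of odd
valuation, those of odd quadratic defect, and the unramified ones. -/
lemma square_class_cases (hπ : Irreducible π) {η : Oˣ} {e : ℕ} (he : 0 < e)
    (h2 : (2 : O) = η * π ^ e) {a : F} (ha : a ≠ 0) : IsSquare a ∨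
    ∃ (a' : O) (s : F), s ≠ 0 ∧ a = algebraMap O F a' * s ^ 2 ∧
      ((∃ ε : Oˣ, a' = π * ε) ∨
        (∃ (ε : Oˣ) (d g : ℕ), e = d + g + 1 ∧ a' = 1 + π ^ (2 * d + 1) * ε) ∨
        ∃ γ : O, a' = 1 + 4 * γ ∧ ∀ t : O, IsUnit (t ^ 2 + t - γ)) := by
  have h2m : (2 : O) ∈ maximalIdeal O := by
    rw [h2, hπ.maximalIdeal_eq, Ideal.mem_span_singleton]
    exact (dvd_pow_self π he.ne').mul_left _
  obtain ⟨u, s, hs, rfl | rfl⟩ := exists_eq_unit_mul_sq hπ ha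
  · have main : ∀ (r : Oˣ) (w : O), (u * r ^ 2 : O) = w →
        algebraMap O F r ≠ 0 ∧
          algebraMap O F u * s ^ 2 = algebraMap O F w * (s / algebraMap O F r) ^ 2 := by
      rintro r _ rfl
      have hr : algebraMap O F r ≠ 0 := (r.isUnit.map (algebraMap O F)).ne_zero
      refine ⟨hr, ?_⟩
      rw [map_mul, map_pow]
      field_simp
    rcases exists_unit_mul_sq_eq hπ he h2 u with ⟨r, ε, d, hd, h⟩ | ⟨r, γ, h⟩
    · obtain ⟨hr, hr'⟩ := main r _ h
      obtain ⟨g, hg⟩ := Nat.exists_eq_add_of_lt hd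
      exact Or.inr ⟨_, _, div_ne_zero hs hr, hr', Or.inr (Or.inl ⟨ε, d, g, hg, rfl⟩)⟩
    · obtain ⟨hr, hr'⟩ := main r _ h
      by_cases hγ : ∀ t : O, IsUnit (t ^ 2 + t - γ)
      · exact Or.inr ⟨_, _, div_ne_zero hs hr, hr', Or.inr (Or.inr ⟨γ, rfl, hγ⟩)⟩
      · push Not at hγ
        obtain ⟨t, ht⟩ := hγ
        left
        rw [hr']
        exact ((isSquare_one_add_four_mul h2m ((mem_maximalIdeal _).2 ht)).map
          (algebraMap O F)).mul (IsSquare.sq _)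
  · exact Or.inr ⟨_, s, hs, rfl, Or.inl ⟨u, rfl⟩⟩

variable (O F) in
/-- Each property is checked on representatives of the square classes. Nondegeneracy comes from an
unramified element `1 + 4ρ`, whose symbol with every element of odd valuation is `-1`. -/
theorem hasLocalSymbol_of_henselian [NeZero (2 : F)] (h2m : (2 : O) ∈ maximalIdeal O) :
    HasLocalSymbol F := by
  obtain ⟨π, hπ⟩ := IsDiscreteValuationRing.exists_irreducible O
  have inj : Function.Injective (algebraMap O F) := FaithfulSMul.algebraMap_injective O F
  have h20 : (2 : O) ≠ 0 := by
    intro h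
    have := congrArg (algebraMap O F) h
    rw [map_ofNat, map_zero] at this
    exact NeZero.ne (2 : F) this
  obtain ⟨e, η, h2⟩ := IsDiscreteValuationRing.eq_unit_mul_pow_irreducible h20 hπ
  have he : 0 < e := by
    rw [pos_iff_ne_zero]
    rintro rfl
    rw [pow_zero, mul_one] at h2
    exact (mem_maximalIdeal _).1 h2m (h2 ▸ η.isUnit)
  refine ⟨?_, ?_, ?_⟩
  · intro a b c ha hb hc
    rcases square_class_cases (O := O) hπ he h2 ha with hsq | ⟨a', s, hs, rfl, H⟩
    · exact Or.inl (IsNorm.of_isSquare hsq ha b)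
    simp only [IsNorm.mul_sq_left hs]
    rcases H with ⟨ε, rfl⟩ | ⟨ε, d, g, rfl, rfl⟩ | ⟨γ, rfl, hγ⟩
    · refine isNorm_index_of_normUnits_index hπ (u₀ := -ε) ?_
        (normUnits_index_of_prime hπ.maximalIdeal_eq h2 he ε) hb hc
      convert IsNorm.neg_self _ using 1
      simp
    · refine isNorm_index_of_normUnits_index hπ (u₀ := -ε) ?_
        (normUnits_index_of_unit hπ.maximalIdeal_eq hπ.ne_zero h2 ε) hb hc
      have hπd : algebraMap O F π ^ d ≠ 0 := pow_ne_zero d ((map_ne_zero_iff _ inj).2 hπ.ne_zero)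
      rw [← IsNorm.mul_sq_right hπd]
      refine ⟨1, 1, ?_⟩
      simp only [map_add, map_mul, map_pow, map_one, map_neg, Units.val_neg]
      ring
    · have hu := isNorm_unit_of_unramified (F := F) h2m hγ
      obtain ⟨u, x, hx, rfl | rfl⟩ := exists_eq_unit_mul_sq (O := O) hπ hb
      · exact Or.inl ((hu u).mul (IsNorm.sq _ x))
      obtain ⟨v, y, hy, rfl | rfl⟩ := exists_eq_unit_mul_sq (O := O) hπ hc
      · exact Or.inr (Or.inl ((hu v).mul (IsNorm.sq _ y)))
      · refine Or.inr (Or.inr ?_)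
        convert ((hu u).mul (hu v)).mul (IsNorm.sq _ (algebraMap O F π * (x * y))) using 1
        simp only [map_mul]
        ring
  · intro a ha hsq
    rcases square_class_cases (O := O) hπ he h2 ha with hsq' | ⟨a', s, hs, rfl, H⟩
    · exact absurd hsq' hsq
    simp only [IsNorm.mul_sq_left hs]
    obtain ⟨ρ, hρ⟩ := exists_forall_isUnit_sq_add_self_sub h2m
    have one_add_ne : ∀ x ∈ maximalIdeal O, algebraMap O F (1 + x) ≠ 0 := by
      intro x hx h0
      have h0' : 1 + x = 0 := (map_eq_zero_iff _ inj).1 h0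
      have : (1 : O) = -x := by linear_combination h0'
      exact (mem_maximalIdeal _).1 (this ▸ (maximalIdeal O).neg_mem hx : (1 : O) ∈ _) isUnit_one
    have h4 : ∀ x : O, 4 * x ∈ maximalIdeal O := fun x => by
      have : 4 * x = 2 * (2 * x) := by ring
      rw [this]
      exact Ideal.mul_mem_right _ _ h2m
    have hπm : π ∈ maximalIdeal O := hπ.maximalIdeal_eq ▸ Ideal.mem_span_singleton_self π
    have prime_ne : ∀ u : Oˣ, algebraMap O F (π * u) ≠ 0 := fun u =>
      (map_ne_zero_iff _ inj).2 (mul_ne_zero hπ.ne_zero u.ne_zero)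
    rcases H with ⟨ε, rfl⟩ | ⟨ε, d, g, rfl, rfl⟩ | ⟨γ, rfl, hγ⟩
    · exact ⟨_, one_add_ne _ (h4 ρ), fun h => not_isNorm_of_unramified hπ hρ ε
        (h.symm (prime_ne ε) (one_add_ne _ (h4 ρ)))⟩
    · -- With `u` the given unit and `w = 1 + 4ρ - u`, the symbol `(u, w) = (1 + 4ρ, -uw)` is `-1`
      -- because `uw` has odd valuation.
      obtain ⟨q, hq⟩ : IsUnit ((ε : O) - η ^ 2 * ρ * π ^ (2 * g + 1)) := by
        refine isUnit_of_dvd_unit_sub (i := 0) (u := ε) hπm ?_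
        exact ⟨η ^ 2 * ρ * π ^ (2 * g), by ring⟩
      obtain ⟨r, hr⟩ : IsUnit (1 + π ^ (2 * d + 1) * (ε : O)) := by
        refine isUnit_of_dvd_unit_sub (i := 0) (u := 1) hπm ?_
        exact ⟨-π ^ (2 * d) * ε, by rw [Units.val_one]; ring⟩
      have hw : 1 + π ^ (2 * d + 1) * ε + -(π ^ (2 * d + 1) * q) = 1 + 4 * ρ := by
        rw [hq]
        linear_combination (-(2 + η * π ^ (d + g + 1)) * ρ) * h2
      have hπd : algebraMap O F π ^ d ≠ 0 := pow_ne_zero d ((map_ne_zero_iff _ inj).2 hπ.ne_zero)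
      refine ⟨algebraMap O F (-(π ^ (2 * d + 1) * q)), (map_ne_zero_iff _ inj).2
        (neg_ne_zero.2 (mul_ne_zero (pow_ne_zero _ hπ.ne_zero) q.ne_zero)), fun h => ?_⟩
      have h' := h.add_left
      rw [← map_add, hw] at h'
      refine not_isNorm_of_unramified hπ hρ (r * q) ((IsNorm.mul_sq_right hπd).1 ?_)
      convert h' using 1
      rw [← hr]
      simp only [map_mul, map_pow, map_neg, Units.val_mul]
      ring
    · exact ⟨_, prime_ne 1, not_isNorm_of_unramified hπ hγ 1⟩
  · have := (isSquare_neg_seven h2m).map (algebraMap O F)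
    simpa only [map_neg, map_ofNat] using this

end DiscreteValuationRing

/-! ### Completions of number fields -/

section Completion

open IsLocalRing HeightOneSpectrum NumberField

variable {K : Type*} [Field K] [NumberField K] (v : HeightOneSpectrum (𝓞 K))

lemma mem_maximalIdeal_adicCompletionIntegers_iff {x : v.adicCompletionIntegers K} :
    x ∈ maximalIdeal (v.adicCompletionIntegers K) ↔ Valued.v (x : v.adicCompletion K) < 1 := by
  rw [mem_maximalIdeal, mem_nonunits_iff, adicCompletionIntegers.isUnit_iff_valued_eq_one,
    lt_iff_le_and_ne]
  exact ⟨fun h => ⟨x.2, h⟩, fun h => h.2⟩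

instance finite_residueField_adicCompletionIntegers :
    Finite (ResidueField (v.adicCompletionIntegers K)) := by
  have : Finite (𝓞 K ⧸ v.asIdeal) := v.asIdeal.finiteQuotientOfFreeOfNeBot v.ne_bot
  let f : 𝓞 K →+* ResidueField (v.adicCompletionIntegers K) :=
    (residue _).comp (algebraMap (𝓞 K) (v.adicCompletionIntegers K))
  have hf : ∀ r ∈ v.asIdeal, f r = 0 := by
    intro r hr
    refine (residue_eq_zero_iff _).2 ((mem_maximalIdeal_adicCompletionIntegers_iff v).2 ?_)
    rw [algebraMap_adicCompletionIntegers_apply, valuedAdicCompletion_eq_valuation']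
    exact (v.valuation_lt_one_iff_mem r).2 hr
  refine Finite.of_surjective (Ideal.Quotient.lift v.asIdeal f hf)
    (Ideal.Quotient.lift_surjective_of_surjective _ _ fun y => ?_)
  obtain ⟨x, rfl⟩ := residue_surjective y
  -- Approximate `x` by an element of `K`, then that element by one of `𝓞 K`.
  obtain ⟨k, hk⟩ : ∃ k : K, Valued.v (algebraMap K _ k - (x : v.adicCompletion K)) < 1 := by
    have hU : {y : v.adicCompletion K | Valued.v (y - x) < 1} ∈ nhds (x : v.adicCompletion K) :=
      Valued.mem_nhds.2 ⟨1, fun y hy => by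
        simpa [Valuation.restrict_lt_iff_lt_embedding] using hy⟩
    obtain ⟨_, hy, k, rfl⟩ := mem_closure_iff_nhds.1 (denseRange_algebraMap K v _) _ hU
    exact ⟨k, hy⟩
  have hk1 : v.valuation K k ≤ 1 := by
    rw [← valuedAdicCompletion_eq_valuation']
    have h := Valuation.map_add (Valued.v (R := v.adicCompletion K)) (algebraMap K _ k - x) x
    rw [sub_add_cancel] at h
    exact h.trans (max_le hk.le x.2)
  obtain ⟨r, hr⟩ := v.exists_valuation_sub_lt_of_integer hk1 1
  refine ⟨r, ?_⟩
  rw [RingHom.comp_apply, ← sub_eq_zero, ← map_sub, residue_eq_zero_iff,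
    mem_maximalIdeal_adicCompletionIntegers_iff]
  rw [← valuedAdicCompletion_eq_valuation', Units.val_one] at hr
  have hr' : Valued.v (algebraMap K (v.adicCompletion K) (algebraMap (𝓞 K) K r) -
      algebraMap K (v.adicCompletion K) k) < 1 := by
    rw [← map_sub]
    exact hr
  have h := Valuation.map_add_lt (Valued.v (R := v.adicCompletion K)) hr' hk
  rw [sub_add_sub_cancel] at h
  exact h

instance isAdicComplete_adicCompletionIntegers :
    IsAdicComplete (maximalIdeal (v.adicCompletionIntegers K)) (v.adicCompletionIntegers K) where
  toIsHausdorff := inferInstance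
  prec' f hf := by
    obtain ⟨π, hπ⟩ := IsDiscreteValuationRing.exists_irreducible (v.adicCompletionIntegers K)
    have hmem : ∀ (n : ℕ) (x y : v.adicCompletionIntegers K),
        x ≡ y [SMOD (maximalIdeal (v.adicCompletionIntegers K) ^ n • ⊤ :
          Submodule (v.adicCompletionIntegers K) (v.adicCompletionIntegers K))] ↔
          π ^ n ∣ x - y := by
      intro n x y
      rw [SModEq.sub_mem, smul_eq_mul, Ideal.mul_top, hπ.maximalIdeal_eq, Ideal.span_singleton_pow,
        Ideal.mem_span_singleton]
    simp only [hmem] at hf ⊢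
    have hπ1 : Valued.v (π : v.adicCompletion K) < 1 :=
      (mem_maximalIdeal_adicCompletionIntegers_iff v).1
        (hπ.maximalIdeal_eq ▸ Ideal.mem_span_singleton_self π)
    have hπ0 : (π : v.adicCompletion K) ≠ 0 := fun h => hπ.ne_zero (Subtype.ext h)
    have hcauchy : CauchySeq fun n => (f n : v.adicCompletion K) := by
      refine (Valued.hasBasis_uniformity _ _).cauchySeq_iff.2 fun γ _ => ?_
      obtain ⟨N, hN⟩ := exists_pow_lt₀ hπ1
        (Units.map (MonoidWithZeroHom.ValueGroup₀.embedding (f := .ofClass (Valued.v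
          (R := v.adicCompletion K)))).toMonoidHom γ)
      refine ⟨N, fun m hm n hn => ?_⟩
      obtain ⟨c, hc⟩ : π ^ N ∣ f n - f m := by
        have := dvd_sub (hf hm) (hf hn)
        rwa [sub_sub_sub_cancel_left] at this
      change Valued.v.restrict ((f n : v.adicCompletion K) - f m) < _
      rw [Valuation.restrict_lt_iff_lt_embedding]
      refine lt_of_le_of_lt ?_ hN
      have hc' := congrArg (fun z : v.adicCompletionIntegers K => (z : v.adicCompletion K)) hc
      push_cast at hc'
      rw [hc', map_mul, map_pow]
      exact mul_le_of_le_one_right' c.2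
    obtain ⟨L, hL⟩ := cauchySeq_tendsto_of_complete hcauchy
    have hlim : ∀ n, ((π : v.adicCompletion K) ^ n)⁻¹ * (f n - L) ∈ v.adicCompletionIntegers K := by
      intro n
      have hcl := (Valued.isClosed_valuationSubring (v.adicCompletion K)).preimage
        (f := fun y => ((π : v.adicCompletion K) ^ n)⁻¹ * (f n - y)) (by fun_prop)
      refine hcl.mem_of_tendsto hL (Filter.eventually_atTop.2 ⟨n, fun m hm => ?_⟩)
      obtain ⟨c, hc⟩ := hf hm
      have hc' := congrArg (fun z : v.adicCompletionIntegers K => (z : v.adicCompletion K)) hc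
      push_cast at hc'
      rw [Set.mem_preimage, hc', inv_mul_cancel_left₀ (pow_ne_zero n hπ0)]
      exact c.2
    have hLO : L ∈ v.adicCompletionIntegers K := by
      have := (v.adicCompletionIntegers K).sub_mem (f 0).2 (hlim 0)
      simpa using this
    refine ⟨⟨L, hLO⟩, fun n => ⟨⟨_, hlim n⟩, Subtype.ext ?_⟩⟩
    push_cast
    rw [mul_inv_cancel_left₀ (pow_ne_zero n hπ0)]

instance henselianLocalRing_adicCompletionIntegers :
    HenselianLocalRing (v.adicCompletionIntegers K) where
  is_henselian f hf a₀ h₁ h₂ :=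
    HenselianRing.is_henselian (I := maximalIdeal _) f hf a₀ h₁ (h₂.map (Ideal.Quotient.mk _))

lemma hasLocalSymbol_adicCompletion (hv : (2 : 𝓞 K) ∈ v.asIdeal) :
    HasLocalSymbol (v.adicCompletion K) := by
  have : CharZero (v.adicCompletion K) := charZero_of_injective_algebraMap
    (algebraMap K (v.adicCompletion K)).injective
  refine hasLocalSymbol_of_henselian (v.adicCompletionIntegers K) (v.adicCompletion K) ?_
  rw [mem_maximalIdeal_adicCompletionIntegers_iff]
  have := (v.valuation_lt_one_iff_mem (K := K) 2).2 hv
  rw [← valuedAdicCompletion_eq_valuation'] at this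
  convert this using 2
  exact (map_ofNat ((algebraMap K (v.adicCompletion K)).comp (algebraMap (𝓞 K) K)) 2).symm

end Completion

/-! ### Base change of a diagonalized form -/

section BaseChange

variable {K L V : Type*} [Field K] [Field L] [Algebra K L] [AddCommGroup V] [Module K V]

/-- The extension of scalars of a form diagonalized over `K` is diagonalized by the same
coefficients. -/
lemma isIsotropic_baseChange_iff [Invertible (2 : K)] {φ : QuadraticForm K V} {n : ℕ}
    {a : Fin n → K} (hφ : φ.Equivalent (QuadraticMap.weightedSumSquares K a)) :
    IsIsotropic (φ.baseChange L) ↔ DiagIsotropic fun i => algebraMap K L (a i) := by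
  obtain ⟨f⟩ := hφ
  let b : Module.Basis (Fin n) K V := .ofEquivFun f.toLinearEquiv
  let B := b.baseChange L
  let _ : Invertible (2 : L) := (Invertible.map (algebraMap K L) 2).copy 2 (map_ofNat _ 2).symm
  have hfb : ∀ i, f (b i) = Pi.single i 1 := fun i => by
    have : b i = f.toLinearEquiv.symm (Pi.single i 1) := by simp [b]
    rw [this]
    exact f.toLinearEquiv.apply_symm_apply _
  have hQ : ∀ x, φ x = ∑ i, a i * (f x i * f x i) := fun x => by
    rw [← f.map_app x, QuadraticMap.weightedSumSquares_apply]
    rfl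
  have hQb : ∀ i, φ (b i) = a i := fun i => by
    simp [hQ, hfb, Pi.single_apply]
  have hortho : (QuadraticMap.associated (R := L) (φ.baseChange L)).IsOrthoᵢ B := by
    intro i j hij
    have hadd : φ (b i + b j) = φ (b i) + φ (b j) := by
      simp only [hQ, map_add, hfb, Pi.add_apply, ← Finset.sum_add_distrib]
      refine Finset.sum_congr rfl fun k _ => ?_
      rcases eq_or_ne k i with rfl | hk
      · simp [hij]
      · simp [hk]
    rw [QuadraticForm.associated_baseChange]
    change LinearMap.BilinForm.baseChange L _ (B i) (B j) = 0
    simp [B, LinearMap.BilinForm.baseChange_tmul, QuadraticMap.associated_apply, hadd]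
  have key : ∀ x : Fin n → L, φ.baseChange L (∑ i, x i • B i) =
      ∑ i, algebraMap K L (a i) * x i ^ 2 := by
    intro x
    rw [← QuadraticMap.basisRepr_apply, QuadraticMap.basisRepr_eq_of_iIsOrtho _ _ hortho,
      QuadraticMap.weightedSumSquares_apply]
    refine Finset.sum_congr rfl fun i _ => ?_
    rw [Module.Basis.baseChange_apply, QuadraticForm.baseChange_tmul, hQb, smul_eq_mul,
      Algebra.smul_def, mul_one, mul_one, ← sq]
  constructor
  · rintro ⟨x, hx, h0⟩
    refine ⟨B.repr x, fun h => hx (B.repr.map_eq_zero_iff.1 (Finsupp.ext (congrFun h))), ?_⟩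
    rw [← key, B.sum_repr, h0]
  · rintro ⟨x, hx, h0⟩
    refine ⟨∑ i, x i • B i, fun h => hx ?_, by rw [key, h0]⟩
    rw [← B.equivFun_symm_apply, LinearEquiv.map_eq_zero_iff] at h
    exact h

end BaseChange

end DyadicIsotropy

open DyadicIsotropy in
open Classical in
theorem mainTheorem6 {K : Type*} [Field K] [NumberField K]
    (v : HeightOneSpectrum (NumberField.RingOfIntegers K))
    (hv : (2 : NumberField.RingOfIntegers K) ∈ v.asIdeal)
    {V : Type*} [AddCommGroup V] [Module K V] (φ : QuadraticForm K V)
    (n : ℕ) (a : Fin n → K) (ha : ∀ i, a i ≠ 0)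
    (hφ : φ.Equivalent (QuadraticMap.weightedSumSquares K a)) :
    -- the decision procedure is correct
    (isotropyTest (fun c => decide (IsLocalSquare v c)) (localHilbert v) a = true ↔
      IsIsotropic (atPrime v φ)) ∧
    -- the criteria it rests on, dimension by dimension
    (n ≤ 1 → ¬ IsIsotropic (atPrime v φ)) ∧
    (n = 2 → (IsIsotropic (atPrime v φ) ↔ IsLocalSquare v (-diagDet a))) ∧
    (n = 3 → (IsIsotropic (atPrime v φ) ↔
      localHilbert v (-1) (-diagDet a) = hasseInvariant (localHilbert v) a)) ∧
    (n = 4 → (IsIsotropic (atPrime v φ) ↔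
      ¬ IsLocalSquare v (diagDet a) ∨
        hasseInvariant (localHilbert v) a = localHilbert v (-1) (-1))) ∧
    (5 ≤ n → IsIsotropic (atPrime v φ)) := by
  let F := v.adicCompletion K
  let c : Fin n → F := fun i => algebraMap K F (a i)
  have hF : HasLocalSymbol F := hasLocalSymbol_adicCompletion v hv
  have : CharZero F := charZero_of_injective_algebraMap (algebraMap K F).injective
  have hc : ∀ i, c i ≠ 0 := fun i => (map_ne_zero _).2 (ha i)
  have hdet : algebraMap K F (diagDet a) = diagDet c := map_prod _ _ _
  have hneg : algebraMap K F (-1) = -1 := by rw [map_neg, map_one]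
  have hndet : algebraMap K F (-diagDet a) = -diagDet c := by rw [map_neg, hdet]
  have hiso : IsIsotropic (atPrime v φ) ↔ DiagIsotropic c := by
    let _ : Invertible (2 : K) := invertibleOfNonzero two_ne_zero
    exact isIsotropic_baseChange_iff hφ
  have h1 : n ≤ 1 → ¬ IsIsotropic (atPrime v φ) := fun hn => by
    rw [hiso]
    exact not_diagIsotropic_of_le_one hn hc
  have h2 : n = 2 → (IsIsotropic (atPrime v φ) ↔ IsLocalSquare v (-diagDet a)) := by
    rintro rfl
    rw [hiso, diagIsotropic_two_iff hc, IsLocalSquare, hndet, diagDet, Fin.prod_univ_two]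
  have h3 : n = 3 → (IsIsotropic (atPrime v φ) ↔
      localHilbert v (-1) (-diagDet a) = hasseInvariant (localHilbert v) a) := by
    rintro rfl
    rw [hiso, hF.diagIsotropic_three_iff hc, localHilbert, hndet, hneg]
    rfl
  have h4 : n = 4 → (IsIsotropic (atPrime v φ) ↔ ¬ IsLocalSquare v (diagDet a) ∨
      hasseInvariant (localHilbert v) a = localHilbert v (-1) (-1)) := by
    rintro rfl
    rw [hiso, IsLocalSquare, hdet, localHilbert, hneg]
    by_cases hsq : IsSquare (diagDet c)
    · rw [hF.diagIsotropic_four_iff_of_isSquare hc hsq, or_iff_right (not_not.2 hsq)]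
      rfl
    · exact iff_of_true (hF.diagIsotropic_four_of_not_isSquare hc hsq) (Or.inl hsq)
  have h5 : 5 ≤ n → IsIsotropic (atPrime v φ) := fun hn =>
    hiso.2 (hF.diagIsotropic_of_five_le hn hc)
  refine ⟨?_, h1, h2, h3, h4, h5⟩
  unfold isotropyTest
  split_ifs with hn1 hn2 hn3 hn4 hsq
  · simpa using h1 hn1
  · subst hn2
    rw [h2 rfl]
    simp [diagDisc]
  · rw [h3 hn3, decide_eq_true_iff]
  · rw [h4 hn4, or_iff_right (not_not.2 (of_decide_eq_true hsq)), decide_eq_true_iff]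
  · exact iff_of_true rfl ((h4 hn4).2 (Or.inl fun h => hsq (decide_eq_true h)))
  · exact iff_of_true rfl (h5 (by omega))
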